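/- Notation. For a finite graded poset $P$ with rank function $r$, $V(P)$ is the complex vector space with basis $P$, $V(P_i)$ is the span of the elements of rank $i$, and the up operator $U$ sends $p$ to the sum of the elements covering $p$. A symmetric Jordan chain is a sequence $(v_1,\dots,v_h)$, $h\ge 1$, of nonzero homogeneous vectors with $U(v_i)=v_{i+1}$, $U(v_h)=0$ and $r(v_1)+r(v_h)=r(P)$; a symmetric Jordan basis (SJB) is a basis of $V(P)$ that is a disjoint union of symmetric Jordan chains. $M(n,k_1,\dots,k_n)=\prod_i\{0,\dots,k_i\}$ with the componentwise order, and $B(n)=M(n,1,\dots,1)$. The linear BTK algorithm. (1) On $V(M(2,p,q))$: if $p=0$ or $q=0$, output the chain $M(2,p,q)$ itself. If $p,q\ge1$, output the chain $(v(0),\dots,v(p+q))$, $v(m)=U^m((0,0))=\sum_{i+j=m}\binom{m}{i}(i,j)$ (over $0\le i\le p$, $0\le j\le q$), together with the images of the chains output for $V(M(2,p-1,q-1))$ under the linear map $(i,j)\mapsto v(i,j+1)$, where $v(i,j)=(p-i)(i,j)-(q-j+1)(i+1,j-1)$. (2) On $V(M(1,k_1))$, output the chain $(0),\dots,(k_1)$.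 For $n\ge2$, each chain $(x_0,\dots,x_l)$ output for $V(M(n-1,k_1,\dots,k_{n-1}))$ is replaced by the images of the chains output for $V(M(2,l,k_n))$ under the linear map $(i,j)\mapsto x_i^{(j)}$, where $x^{(j)}$ is obtained from $x$ by appending $j$ as the $n$-th coordinate of each basis element. Let $O(n)$ be the output for $B(n)$. Representations. $S_n$ acts on $V(B(n))$ by permuting coordinates. $S_i\subseteq S_n$ fixes the letters $i+1,\dots,n$. A Gelfand–Tsetlin (GZ) vector of an $S_n$-module $W$ is a nonzero vector of $L_1$ for some chain $L_1\subseteq\dots\subseteq L_n\subseteq W$ in which each $L_i$ is an irreducible $S_i$-submodule; a GZ-basis of $W$ is a basis of $W$ consisting of one nonzero vector on each line spanned by a GZ vector. Let $X_i=\sum_{j<i}(j\,i)\in\mathbb C[S_n]$ be the Young–Jucys–Murphy elements and, for an $S_n$-module $V$ and $\alpha\in\mathbb C^n$, $V(\alpha)=\{v\in V: X_iv=\alpha_iv,\ 1\le i\le n\}$. Write $\alpha\sim\beta$ if $\alpha$ and $\beta$ are weights of GZ vectors of one and the same irreducible $S_n$-module. For $\alpha\sim\beta$ there is a linear isomorphism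 $f_{\alpha,\beta}:V(\alpha)\to V(\beta)$, unique up to scalars, such that $\mathbb C[S_n]v\cap V(\beta)$ is spanned by $f_{\alpha,\beta}(v)$ for every $v\in V(\alpha)$. Theorem. Let $n\ge 1$. The set $O(n)$ is the symmetric Gelfand–Tsetlin basis of $V(B(n))$; that is: (1) $O(n)$ is an SJB of $V(B(n))$, orthogonal for the inner product making $B(n)$ orthonormal, and for $0\le i\le n$ the set $O(n)\cap V(B(n)_i)$ is a GZ-basis of the $S_n$-module $V(B(n)_i)$. (2) Every vector of $O(n)$ is a simultaneous eigenvector of $X_1,\dots,X_n$; and for $\alpha\sim\beta$ the isomorphism $f_{\alpha,\beta}$ exists and, for every $v\in O(n)\cap V(\alpha)$, some multiple of $f_{\alpha,\beta}(v)$ lies in $O(n)$. (3) $O(n)$ is determined up to scalars by either property: every SJB of $V(B(n))$ satisfying (1), or satisfying (2), in place of $O(n)$ consists of the chains of $O(n)$, each multiplied by a nonzero scalar. -/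

import Mathlib

open scoped ComplexConjugate

noncomputable section

namespace LinearBTK

/-! ## Graded posets and symmetric Jordan bases

For a finite set `P`, the complex vector space `V(P)` with basis `P` is `P →₀ ℂ`; the element `p` of
`P` is the vector `Finsupp.single p 1`. -/

section Poset

variable {P : Type*} [Fintype P] [PartialOrder P]

open Classical in
/-- The up operator: it sends `p` to the sum of the elements covering `p`. -/
def upOp (P : Type*) [Fintype P] [PartialOrder P] : (P →₀ ℂ) →ₗ[ℂ] (P →₀ ℂ) :=
  Finsupp.linearCombination ℂ
    (fun p : P => ∑ q ∈ Finset.univ.filter (fun q => p ⋖ q), Finsupp.single q (1 : ℂ))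

/-- The subspace `V(P_i)` spanned by the elements of rank `i`. -/
def level {P : Type*} (r : P → ℕ) (i : ℕ) : Submodule ℂ (P →₀ ℂ) :=
  Finsupp.supported ℂ ℂ {p | r p = i}

/-- `c = (v_1, …, v_h)` is a symmetric Jordan chain in `V(P)`, where `r` is the rank function
of `P`: the `v_i` are nonzero and homogeneous, `U v_i = v_{i+1}`, `U v_h = 0`, and the ranks of
`v_1` and `v_h` add up to the rank of `P`. -/
structure IsSymmetricJordanChain (r : P → ℕ) (c : List (P →₀ ℂ)) : Prop where
  ne_nil : c ≠ []
  ne_zero : ∀ v ∈ c, v ≠ 0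
  homogeneous : ∀ v ∈ c, ∃ i, v ∈ level r i
  up_eq : c.IsChain (fun v w => upOp P v = w)
  up_last : upOp P (c.getLast ne_nil) = 0
  symmetric : ∃ i j, c.head ne_nil ∈ level r i ∧ c.getLast ne_nil ∈ level r j ∧
    i + j = Finset.univ.sup r

/-- The set of all vectors that occur in the chains of a list of chains. -/
def vectors {V : Type*} (L : List (List V)) : Set V := {v | ∃ c ∈ L, v ∈ c}

/-- The list `L` of chains is a symmetric Jordan basis of `V(P)`: all its chains are symmetric
Jordan chains, and all their vectors together (listed with repetitions) form a basis. -/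
structure IsSJB (r : P → ℕ) (L : List (List (P →₀ ℂ))) : Prop where
  chains : ∀ c ∈ L, IsSymmetricJordanChain r c
  linearIndependent : LinearIndependent ℂ L.flatten.get
  span_eq_top : Submodule.span ℂ (vectors L) = ⊤

/-- The standard inner product on `V(P)`, for which `P` is orthonormal. -/
def stdInner (v w : P →₀ ℂ) : ℂ := ∑ p, conj (v p) * w p

end Poset

/-! ## The linear BTK algorithm -/

/-- The poset `M(n, k_1, …, k_n)` with the componentwise order. -/
abbrev M (n : ℕ) (k : Fin n → ℕ) : Type := (i : Fin n) → Fin (k i + 1)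

/-- The rank function of `M(n, k_1, …, k_n)`. -/
def rk {n : ℕ} {k : Fin n → ℕ} (a : M n k) : ℕ := ∑ i, (a i : ℕ)

/-- The vector `v(m) = U^m (0,0) = ∑ (m choose i) (i,j)`, over `0 ≤ i ≤ p`, `0 ≤ j ≤ q` with
`i + j = m`, of `V(M(2,p,q))`. -/
def mainVec (p q m : ℕ) : Fin (p + 1) × Fin (q + 1) →₀ ℂ :=
  ∑ x : Fin (p + 1) × Fin (q + 1),
    if (x.1 : ℕ) + (x.2 : ℕ) = m then Finsupp.single x (m.choose x.1 : ℂ) else 0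

/-- The linear map `V(M(2,p,q)) → V(M(2,p+1,q+1))`, `(i,j) ↦ v(i,j+1)`, where
`v(i,j) = ((p+1)-i) (i,j) - ((q+1)-j+1) (i+1,j-1)`. -/
def transfer (p q : ℕ) :
    (Fin (p + 1) × Fin (q + 1) →₀ ℂ) →ₗ[ℂ] (Fin (p + 2) × Fin (q + 2) →₀ ℂ) :=
  Finsupp.linearCombination ℂ (fun x : Fin (p + 1) × Fin (q + 1) =>
    Finsupp.single (x.1.castSucc, x.2.succ) ((p : ℂ) + 1 - ((x.1 : ℕ) : ℂ)) -
      Finsupp.single (x.1.succ, x.2.castSucc) ((q : ℂ) + 1 - ((x.2 : ℕ) : ℂ)))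

/-- The algorithm for `V(M(2,p,q))`, where `M(2,p,q)` is written as a product of two chains:
if `p` or `q` is `0`, the chain `M(2,p,q)` itself; otherwise the chain generated by `(0,0)`
together with the transferred chains of `V(M(2,p-1,q-1))`. -/
def btkTwo : (p q : ℕ) → List (List (Fin (p + 1) × Fin (q + 1) →₀ ℂ))
  | 0, q => [List.ofFn fun j : Fin (q + 1) => Finsupp.single (0, j) 1]
  | p + 1, 0 => [List.ofFn fun i : Fin (p + 2) => Finsupp.single (i, 0) 1]
  | p + 1, q + 1 =>
      (List.range (p + q + 3)).map (mainVec (p + 1) (q + 1)) ::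
        (btkTwo p q).map (List.map (transfer p q))

/-- The linear map sending `(a_1, …, a_n)` to `(a_1, …, a_n, j)`. -/
def appendLast {n : ℕ} (k : Fin (n + 1) → ℕ) (j : Fin (k (Fin.last n) + 1)) :
    (M n (fun i => k i.castSucc) →₀ ℂ) →ₗ[ℂ] (M (n + 1) k →₀ ℂ) :=
  Finsupp.lmapDomain ℂ ℂ
    (fun a => (Fin.snoc (α := fun i => Fin (k i + 1)) a j : M (n + 1) k))

/-- For a chain `c = (x_0, …, x_l)`, the linear map sending the element `(i,j)` of
`M(2, l, k_{n+1})` to `x_i` with last coordinate `j` appended. -/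
def place {n : ℕ} (k : Fin (n + 1) → ℕ) (c : List (M n (fun i => k i.castSucc) →₀ ℂ)) :
    (Fin (c.length - 1 + 1) × Fin (k (Fin.last n) + 1) →₀ ℂ) →ₗ[ℂ] (M (n + 1) k →₀ ℂ) :=
  Finsupp.linearCombination ℂ (fun x => appendLast k x.2 (c.getD x.1 0))

/-- The linear BTK algorithm for `M(n, k_1, …, k_n)`, returning a list of chains.  Each chain
`(x_0, …, x_l)` produced for `k_1, …, k_n` is replaced by the chains of `V(M(2, l, k_{n+1}))`,
carried over by `place`.  The recursion starts at the one-point poset `n = 0`; its first step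
yields the chain `0 < 1 < ⋯ < k_1`, and its second step yields `btkTwo k_1 k_2`. -/
def linearBTK : (n : ℕ) → (k : Fin n → ℕ) → List (List (M n k →₀ ℂ))
  | 0, _ => [[Finsupp.single (fun i => i.elim0) 1]]
  | n + 1, k =>
      (linearBTK n (fun i => k i.castSucc)).flatMap fun c =>
        (btkTwo (c.length - 1) (k (Fin.last n))).map (List.map (place k c))

/-- The uniform case `M(n,k)`. -/
abbrev MU (n k : ℕ) : Type := M n (fun _ => k)

/-- The Boolean algebra `B(n) = M(n,1)`. -/
abbrev B (n : ℕ) : Type := MU n 1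

/-- The list of chains `O(n)` produced by the linear BTK algorithm on `B(n)`. -/
def O (n : ℕ) : List (List (B n →₀ ℂ)) := linearBTK n (fun _ => 1)

/-! ## Representations of the symmetric groups -/

section Rep

variable {n : ℕ} {V : Type*} [AddCommGroup V] [Module ℂ V]

/-- The subgroup `S_i` of `S_n`: the permutations fixing all letters but the first `i`. -/
def youngSub (n i : ℕ) : Subgroup (Equiv.Perm (Fin n)) where
  carrier := {π | ∀ j : Fin n, i ≤ (j : ℕ) → π j = j}
  one_mem' := fun _ _ => rfl
  mul_mem' := fun {a b} ha hb j hj => by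
    rw [Equiv.Perm.mul_apply, hb j hj, ha j hj]
  inv_mem' := fun {a} ha j hj => by
    rw [Equiv.Perm.inv_eq_iff_eq, ha j hj]

/-- `W` is invariant under the group `H`. -/
def IsInvariant (ρ : Representation ℂ (Equiv.Perm (Fin n)) V)
    (H : Subgroup (Equiv.Perm (Fin n))) (W : Submodule ℂ V) : Prop :=
  ∀ π ∈ H, ∀ v ∈ W, ρ π v ∈ W

/-- `W` is an irreducible `H`-submodule of `V`. -/
structure IsIrreducibleSub (ρ : Representation ℂ (Equiv.Perm (Fin n)) V)
    (H : Subgroup (Equiv.Perm (Fin n))) (W : Submodule ℂ V) : Prop where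
  invariant : IsInvariant ρ H W
  ne_bot : W ≠ ⊥
  eq_bot_or_eq : ∀ W' ≤ W, IsInvariant ρ H W' → W' = ⊥ ∨ W' = W

/-- `v` is a Gelfand–Tsetlin vector of the `S_n`-submodule `W`: a nonzero vector of `L_1`, for
some chain `L_1 ⊆ L_2 ⊆ ⋯ ⊆ L_n ⊆ W` in which `L_i` is an irreducible `S_i`-submodule. -/
def IsGZVector (ρ : Representation ℂ (Equiv.Perm (Fin n)) V) (W : Submodule ℂ V) (v : V) :
    Prop :=
  v ≠ 0 ∧ ∃ L : ℕ → Submodule ℂ V,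
    (∀ i, 1 ≤ i → i ≤ n → IsIrreducibleSub ρ (youngSub n i) (L i)) ∧
    (∀ i, 1 ≤ i → i < n → L i ≤ L (i + 1)) ∧ L n ≤ W ∧ v ∈ L 1

/-- `S` is a Gelfand–Tsetlin basis of the `S_n`-submodule `W`: a basis of `W` made of one
nonzero vector on each of the lines `L_1` obtained from chains `L_1 ⊆ ⋯ ⊆ L_n ⊆ W` of irreducible
submodules. (When the restrictions are multiplicity free, the irreducible submodules are
the members of the canonical decompositions into irreducibles.) -/
structure IsGZBasis (ρ : Representation ℂ (Equiv.Perm (Fin n)) V) (W : Submodule ℂ V)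
    (S : Set V) : Prop where
  linearIndependent : LinearIndepOn ℂ id S
  span_eq : Submodule.span ℂ S = W
  isGZVector : ∀ v ∈ S, IsGZVector ρ W v
  exists_smul : ∀ v, IsGZVector ρ W v → ∃ u ∈ S, ∃ c : ℂ, v = c • u

/-- The Young–Jucys–Murphy element `X_i = ∑_{j < i} (j i)` of `ℂ[S_n]`. -/
def yjm (n : ℕ) (i : Fin n) : MonoidAlgebra ℂ (Equiv.Perm (Fin n)) :=
  ∑ j ∈ Finset.univ.filter (fun j => j < i),
    MonoidAlgebra.of ℂ (Equiv.Perm (Fin n)) (Equiv.swap j i)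

/-- `v` is a simultaneous eigenvector of `X_1, …, X_n`. -/
def IsYJMEigenvector (ρ : Representation ℂ (Equiv.Perm (Fin n)) V) (v : V) : Prop :=
  v ≠ 0 ∧ ∀ i, ∃ a : ℂ, ρ.asAlgebraHom (yjm n i) v = a • v

/-- The weight space `V(α) = {v | X_i v = α_i v for all i}`. -/
def weightSpace (ρ : Representation ℂ (Equiv.Perm (Fin n)) V) (α : Fin n → ℂ) :
    Submodule ℂ V :=
  ⨅ i, Module.End.eigenspace (ρ.asAlgebraHom (yjm n i)) (α i)

/-- The submodule `ℂ[S_n] v` generated by `v`. -/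
def cyclic (ρ : Representation ℂ (Equiv.Perm (Fin n)) V) (v : V) : Submodule ℂ V :=
  Submodule.span ℂ (Set.range fun π => ρ π v)

/-- `α ∼ β`: the tuples `α` and `β` are weights of Gelfand–Tsetlin vectors of one and the same
irreducible `S_n`-module (in particular both belong to `spec(n)`). -/
def WeightEquiv (n : ℕ) (α β : Fin n → ℂ) : Prop :=
  ∃ (L : Type) (_ : AddCommGroup L) (_ : Module ℂ L) (_ : FiniteDimensional ℂ L)
    (σ : Representation ℂ (Equiv.Perm (Fin n)) L),
    IsIrreducibleSub σ ⊤ ⊤ ∧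
    (∃ v ∈ weightSpace σ α, IsGZVector σ ⊤ v) ∧ (∃ w ∈ weightSpace σ β, IsGZVector σ ⊤ w)

/-- `f` is the canonical isomorphism `f_{α,β} : V(α) → V(β)` (which is unique up to scalars):
for `v ∈ V(α)`, the subspace `ℂ[S_n] v ∩ V(β)` is generated by `f v`. -/
def IsCanonicalIso (ρ : Representation ℂ (Equiv.Perm (Fin n)) V) (α β : Fin n → ℂ)
    (f : weightSpace ρ α ≃ₗ[ℂ] weightSpace ρ β) : Prop :=
  ∀ v : weightSpace ρ α, cyclic ρ (v : V) ⊓ weightSpace ρ β = Submodule.span ℂ {(f v : V)}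

end Rep

/-- The action of `S_n` on `V(M(n,k))` by permutation of coordinates. -/
def permRep (n k : ℕ) : Representation ℂ (Equiv.Perm (Fin n)) (MU n k →₀ ℂ) where
  toFun π := Finsupp.lmapDomain ℂ ℂ (fun (a : MU n k) (i : Fin n) => a (π⁻¹ i))
  map_one' := Finsupp.lhom_ext fun a b => by
    rw [Finsupp.lmapDomain_apply, Finsupp.mapDomain_single]
    rfl
  map_mul' π τ := Finsupp.lhom_ext fun a b => by
    rw [Module.End.mul_apply, Finsupp.lmapDomain_apply, Finsupp.lmapDomain_apply,
      Finsupp.lmapDomain_apply, Finsupp.mapDomain_single, Finsupp.mapDomain_single,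
      Finsupp.mapDomain_single, mul_inv_rev]
    rfl

/-- The list `L` of chains is a symmetric Gelfand–Tsetlin basis of `V(M(n,k))`. -/
structure IsSGZB (n k : ℕ) (L : List (List (MU n k →₀ ℂ))) : Prop where
  isSJB : IsSJB rk L
  eigenvector : ∀ v ∈ vectors L, IsYJMEigenvector (permRep n k) v
  transport : ∀ α β : Fin n → ℂ, WeightEquiv n α β →
    ∃ f : weightSpace (permRep n k) α ≃ₗ[ℂ] weightSpace (permRep n k) β,
      IsCanonicalIso (permRep n k) α β f ∧
      ∀ v : weightSpace (permRep n k) α, (v : MU n k →₀ ℂ) ∈ vectors L →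
        ∃ c : ℂ, c • (f v : MU n k →₀ ℂ) ∈ vectors L

/-- The list `L` of chains is an orthogonal symmetric Jordan basis of `V(B(n))` that is the union
of Gelfand–Tsetlin bases of the `S_n`-modules `V(B(n)_i)`, `0 ≤ i ≤ n`. -/
structure IsGZUnion (n : ℕ) (L : List (List (B n →₀ ℂ))) : Prop where
  isSJB : IsSJB rk L
  orthogonal : ∀ v ∈ vectors L, ∀ w ∈ vectors L, v ≠ w → stdInner v w = 0
  gzBasis : ∀ i ≤ n, IsGZBasis (permRep n 1) (level rk i) {v ∈ vectors L | v ∈ level rk i}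

/-- The two lists consist of the same chains, up to a nonzero scalar for each chain. -/
def SameUpToScalars {V : Type*} [AddCommGroup V] [Module ℂ V] (L L' : List (List V)) : Prop :=
  (∀ c ∈ L, ∃ c' ∈ L', ∃ a : ℂ, a ≠ 0 ∧ c' = c.map (fun v => a • v)) ∧
    (∀ c' ∈ L', ∃ c ∈ L, ∃ a : ℂ, a ≠ 0 ∧ c' = c.map (fun v => a • v))

end LinearBTK

end

/-! Words in the letters `0, …, k` form a basis of `(ℂ^(k+1))^{⊗ n}`, on which the matrix units of
`𝔤𝔩(k+1)` act by replacing letters; for `k = 1` the up operator is the raising operator of `𝔰𝔩₂`.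
Passing from `B (n - 1)` to `B n` tensors the `𝔰𝔩₂`-module spanned by a chain with `ℂ²`, so by
Clebsch–Gordan it splits into at most two chains. Their bottoms are the lowest weight vectors
`t ⊗ 0` and `(n - 1 - 2r) t ⊗ 1 - U t ⊗ 0`, where `t` has rank `r` in `B (n - 1)`, and these are
the vectors produced by the algorithm.

The last Young–Jucys–Murphy element is a Casimir tensor, so each chain consists of eigenvectors of
`X_1, …, X_n` with one common weight, and distinct chains have distinct weights. As the `X_i` are
self-adjoint, chains and levels are pairwise orthogonal; hence weight and rank determine a vector
up to scalars.

A GZ vector is a common eigenvector of the `X_i`, because the sum of the transpositions of `S_i` is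
central and acts on an irreducible module by a scalar. Conversely the `S_i`-submodule generated by a
vector that spans its weight space in an invariant subspace is irreducible. Both criteria in the
statement therefore make a symmetric Jordan basis consist of multiples of the vectors of `O n`.

If one weight of an irreducible module is a weight of a vector of `O n`, then the module embeds into
`V(B n)`: the sum of all `χ(σ) σ`, where `χ` is the permutation character of `B n`, acts on the
weight vector by the nonzero scalar `∏ (2 + α_i)`. Since the `S_n`-action commutes with `U`, the
isomorphisms `f_{α,β}` carry chains to chains. -/

noncomputable section

namespace LinearBTK

lemma level_unique {P : Type*} {r : P → ℕ} {i j : ℕ} {v : P →₀ ℂ} (hv : v ≠ 0)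
    (hi : v ∈ level r i) (hj : v ∈ level r j) : i = j := by
  obtain ⟨p, hp⟩ := Finsupp.ne_iff.1 hv
  have hp : p ∈ (v.support : Set P) := Finsupp.mem_support_iff.2 hp
  exact (hi hp).symm.trans (hj hp)

section Inner

variable {P : Type*} [Fintype P]

/-- The inner product `stdInner` as a sesquilinear form. -/
def stdForm (P : Type*) [Fintype P] : (P →₀ ℂ) →ₗ⋆[ℂ] (P →₀ ℂ) →ₗ[ℂ] ℂ :=
  LinearMap.mk₂'ₛₗ _ _ stdInner
    (fun u v w => by simp [stdInner, add_mul, Finset.sum_add_distrib])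
    (fun c v w => by simp [stdInner, Finset.mul_sum, mul_assoc])
    (fun u v w => by simp [stdInner, mul_add, Finset.sum_add_distrib])
    (fun c v w => by simp [stdInner, Finset.mul_sum, mul_left_comm])

lemma stdForm_apply (v w : P →₀ ℂ) : stdForm P v w = stdInner v w := rfl

lemma stdInner_smul_left (c : ℂ) (v w : P →₀ ℂ) : stdInner (c • v) w = conj c * stdInner v w :=
  (stdForm P).map_smulₛₗ₂ c v w

lemma stdInner_smul_right (c : ℂ) (v w : P →₀ ℂ) : stdInner v (c • w) = c * stdInner v w :=
  (stdForm P v).map_smul c w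

open scoped ComplexOrder in
lemma stdInner_self_eq_zero {v : P →₀ ℂ} : stdInner v v = 0 ↔ v = 0 :=
  (dotProduct_star_self_eq_zero (v := ⇑v)).trans (by rw [← Finsupp.coe_zero, DFunLike.coe_fn_eq])

lemma stdInner_eq_zero_of_level_ne {r : P → ℕ} {i j : ℕ} {v w : P →₀ ℂ} (hv : v ∈ level r i)
    (hw : w ∈ level r j) (h : i ≠ j) : stdInner v w = 0 := by
  rw [level, Finsupp.mem_supported'] at hv hw
  refine Finset.sum_eq_zero fun p _ => ?_
  by_cases hp : r p = i
  · rw [hw p fun hp' => h (hp.symm.trans hp'), mul_zero]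
  · rw [hv p hp, map_zero, zero_mul]

lemma linearIndependent_of_orthogonal {ι : Type*} {v : ι → P →₀ ℂ} (h0 : ∀ i, v i ≠ 0)
    (h : Pairwise fun i j => stdInner (v i) (v j) = 0) : LinearIndependent ℂ v :=
  LinearMap.linearIndependent_of_isOrthoᵢ (B := stdForm P) (fun _ _ hij => h hij) fun i hi =>
    h0 i (stdInner_self_eq_zero.1 hi)

lemma stdInner_eq_zero_comm {v w : P →₀ ℂ} : stdInner v w = 0 ↔ stdInner w v = 0 := by
  have hconj : conj (stdInner v w) = stdInner w v := by simp [stdInner, mul_comm]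
  rw [← hconj, map_eq_zero]

instance : Std.Symm fun v w : P →₀ ℂ => stdInner v w = 0 := ⟨fun _ _ => stdInner_eq_zero_comm.1⟩

lemma linearIndependent_get_of_orthogonal {l : List (P →₀ ℂ)} (h0 : ∀ v ∈ l, v ≠ 0)
    (h : l.Pairwise fun v w => stdInner v w = 0) : LinearIndependent ℂ l.get := by
  refine linearIndependent_of_orthogonal (fun i => h0 _ (l.get_mem i)) fun i j hij => ?_
  rw [List.pairwise_iff_get] at h
  rcases hij.lt_or_gt with hlt | hgt
  · exact h i j hlt
  · exact stdInner_eq_zero_comm.1 (h j i hgt)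

lemma mem_span_of_stdInner_eq_zero {S T : Set (P →₀ ℂ)} (hS : Submodule.span ℂ S = ⊤)
    (hST : S.Pairwise fun x y => stdInner x y = 0) {v : P →₀ ℂ}
    (h : ∀ x ∈ S, x ∉ T → stdInner x v = 0) : v ∈ Submodule.span ℂ (S ∩ T) := by
  classical
  obtain ⟨c, hcS, rfl⟩ := Submodule.mem_span_set.1 (hS ▸ Submodule.mem_top : v ∈ Submodule.span ℂ S)
  refine Submodule.sum_mem _ fun x hx => ?_
  by_cases hxT : x ∈ T
  · exact Submodule.smul_mem _ _ (Submodule.subset_span ⟨hcS hx, hxT⟩)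
  · have hsum : stdInner x (c.sum fun y a => a • y) = c x * stdInner x x := by
      rw [Finsupp.sum, ← stdForm_apply, map_sum, Finset.sum_eq_single_of_mem x hx]
      · rw [stdForm_apply, stdInner_smul_right]
      · intro y hy hyx
        rw [stdForm_apply, stdInner_smul_right, hST (hcS hx) (hcS hy) hyx.symm, mul_zero]
    rcases mul_eq_zero.1 (hsum ▸ h x (hcS hx) hxT) with h0 | h0
    · simp only [h0, zero_smul, Submodule.zero_mem]
    · simp only [stdInner_self_eq_zero.1 h0, smul_zero, Submodule.zero_mem]

end Inner

section Letters

variable {n k : ℕ}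

/-- The linear map appending the letter `s` to words in the letters `0, …, k`. -/
abbrev snocMap (s : Fin (k + 1)) : (MU n k →₀ ℂ) →ₗ[ℂ] (MU (n + 1) k →₀ ℂ) :=
  appendLast (fun _ => k) s

/-- The operator sending a word to the sum of the words obtained from it by replacing one letter
`s` by the letter `t`: the action of a matrix unit of `𝔤𝔩(k + 1)` on `(ℂ^(k + 1))^{⊗ n}`. -/
def shift (s t : Fin (k + 1)) : Module.End ℂ (MU n k →₀ ℂ) :=
  Finsupp.linearCombination ℂ fun a : MU n k =>
    ∑ i, if a i = s then Finsupp.single (Function.update a i t) 1 else 0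

lemma shift_single (s t : Fin (k + 1)) (a : MU n k) :
    shift s t (Finsupp.single a 1) =
      ∑ i, if a i = s then Finsupp.single (Function.update a i t : MU n k) (1 : ℂ) else 0 := by
  rw [shift, Finsupp.linearCombination_single, one_smul]

lemma snocMap_single (s : Fin (k + 1)) (a : MU n k) (c : ℂ) :
    snocMap s (Finsupp.single a c) = Finsupp.single (Fin.snoc a s : MU (n + 1) k) c :=
  Finsupp.mapDomain_single

lemma lhom_ext_snocMap {W : Type*} [AddCommGroup W] [Module ℂ W]
    {f g : (MU (n + 1) k →₀ ℂ) →ₗ[ℂ] W} (h : ∀ s v, f (snocMap s v) = g (snocMap s v)) :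
    f = g := by
  refine Finsupp.lhom_ext fun a c => ?_
  have ha := h (a (Fin.last n)) (Finsupp.single (Fin.init a) c)
  rwa [snocMap_single, Fin.snoc_init_self] at ha

lemma snocMap_apply_snoc (s t : Fin (k + 1)) (v : MU n k →₀ ℂ) (a : MU n k) :
    snocMap s v (Fin.snoc a t : MU (n + 1) k) = if s = t then v a else 0 := by
  induction v using Finsupp.induction_linear with
  | zero => simp
  | add f g hf hg => rw [map_add, Finsupp.add_apply, hf, hg]; split_ifs <;> simp
  | single b c =>
    rw [snocMap_single, Finsupp.single_apply, Finsupp.single_apply]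
    by_cases h : s = t <;> simp [Fin.snoc_inj, h]

lemma snocMap_injective (s : Fin (k + 1)) :
    Function.Injective (snocMap s : (MU n k →₀ ℂ) →ₗ[ℂ] (MU (n + 1) k →₀ ℂ)) := by
  intro v w h
  ext a
  simpa only [snocMap_apply_snoc, if_true] using DFunLike.congr_fun h (Fin.snoc a s : MU (n + 1) k)

lemma shift_snocMap (s t u : Fin (k + 1)) (v : MU n k →₀ ℂ) :
    shift s t (snocMap u v) = snocMap u (shift s t v) + if u = s then snocMap t v else 0 := by
  suffices h : shift s t ∘ₗ snocMap u =
      snocMap (n := n) u ∘ₗ shift s t + if u = s then snocMap t else 0 by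
    have := LinearMap.congr_fun h v
    split_ifs at this ⊢ <;> simpa using this
  refine Finsupp.lhom_ext' fun a => LinearMap.ext_ring ?_
  simp only [LinearMap.comp_apply, LinearMap.add_apply, Finsupp.lsingle_apply, shift_single,
    snocMap_single, map_sum, Fin.sum_univ_castSucc, Fin.snoc_castSucc, Fin.snoc_last,
    Fin.update_snoc_last]
  congr 1
  · refine Finset.sum_congr rfl fun i _ => ?_
    split_ifs
    · rw [snocMap_single, Fin.snoc_update]
    · rw [map_zero]
  · split_ifs <;> simp only [snocMap_single, LinearMap.zero_apply]

lemma shift_shift (s t u v : Fin (k + 1)) (x : MU n k →₀ ℂ) :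
    shift s t (shift u v x) = shift u v (shift s t x) + (if s = v then shift u t x else 0) -
      if t = u then shift s v x else 0 := by
  induction n with
  | zero =>
    have h : ∀ (s t : Fin (k + 1)) (x : MU 0 k →₀ ℂ), shift s t x = 0 := fun s t x => by
      simp [shift, Finsupp.linearCombination_apply]
    simp [h]
  | succ n ih =>
    suffices h : shift s t ∘ₗ shift u v = shift u v ∘ₗ shift s t +
        (if s = v then (shift u t : Module.End ℂ (MU (n + 1) k →₀ ℂ)) else 0) -
          if t = u then shift s v else 0 by
      have := LinearMap.congr_fun h x
      split_ifs at this ⊢ <;> simpa using this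
    refine lhom_ext_snocMap fun w x => ?_
    simp only [LinearMap.comp_apply, LinearMap.sub_apply, LinearMap.add_apply, shift_snocMap,
      map_add, apply_ite (shift (n := n + 1) _ _), map_zero, ih]
    split_ifs <;> subst_vars <;> simp_all [shift_snocMap] <;> abel

lemma sum_shift_self (v : MU n k →₀ ℂ) : ∑ s, shift s s v = (n : ℂ) • v := by
  suffices h : ∑ s, shift s s = (n : ℂ) • (1 : Module.End ℂ (MU n k →₀ ℂ)) by
    simpa using LinearMap.congr_fun h v
  refine Finsupp.lhom_ext' fun a => LinearMap.ext_ring ?_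
  simp only [LinearMap.comp_apply, LinearMap.sum_apply, Finsupp.lsingle_apply, shift_single]
  rw [Finset.sum_comm]
  simp

lemma shift_self_single (s : Fin (k + 1)) (a : MU n k) :
    shift s s (Finsupp.single a 1) = (Finset.card {i | a i = s} : ℂ) • Finsupp.single a 1 := by
  rw [shift_single, Finset.card_filter, Nat.cast_sum, Finset.sum_smul]
  refine Finset.sum_congr rfl fun i _ => ?_
  split_ifs with h
  · rw [← h, Function.update_eq_self, Nat.cast_one, one_smul]
  · rw [Nat.cast_zero, zero_smul]

lemma shift_self_apply (s : Fin (k + 1)) (v : MU n k →₀ ℂ) (a : MU n k) :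
    shift s s v a = Finset.card {i | a i = s} * v a := by
  induction v using Finsupp.induction_linear with
  | zero => simp
  | add f g hf hg => rw [map_add, Finsupp.add_apply, hf, hg, Finsupp.add_apply, mul_add]
  | single b c =>
    rw [← Finsupp.smul_single_one b c, map_smul, shift_self_single]
    by_cases hab : b = a
    · simp [hab, mul_comm]
    · simp [Finsupp.single_eq_of_ne' hab]

end Letters

section Boolean

variable {n : ℕ}

/-- The raising operator of `V(B n)`. -/
abbrev up : Module.End ℂ (B n →₀ ℂ) := shift 0 1

/-- The lowering operator of `V(B n)`. -/
abbrev down : Module.End ℂ (B n →₀ ℂ) := shift 1 0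

lemma covBy_iff_update (a b : B n) : a ⋖ b ↔ ∃ i, a i = 0 ∧ b = Function.update a i 1 := by
  have covBy_iff : ∀ x y : Fin 2, x ⋖ y ↔ x = 0 ∧ y = 1 := by
    simp only [Fin.covBy_iff, Nat.covBy_iff_add_one_eq]
    decide
  rw [Pi.covBy_iff_exists_right_eq]
  constructor
  · rintro ⟨i, x, h, rfl⟩
    obtain ⟨hi, rfl⟩ := (covBy_iff _ _).1 h
    exact ⟨i, hi, rfl⟩
  · rintro ⟨i, hi, rfl⟩
    exact ⟨i, 1, (covBy_iff _ _).2 ⟨hi, rfl⟩, rfl⟩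

lemma upOp_eq_up (n : ℕ) : upOp (B n) = up := by
  classical
  refine Finsupp.lhom_ext' fun a => LinearMap.ext_ring ?_
  simp only [LinearMap.comp_apply, Finsupp.lsingle_apply, shift_single, upOp,
    Finsupp.linearCombination_single, one_smul]
  rw [← Finset.sum_filter]
  symm
  refine Finset.sum_bij (fun i _ => (Function.update a i 1 : B n)) ?_ ?_ ?_ fun _ _ => rfl
  · intro i hi
    exact Finset.mem_filter.2
      ⟨Finset.mem_univ _, (covBy_iff_update _ _).2 ⟨i, (Finset.mem_filter.1 hi).2, rfl⟩⟩
  · intro i hi j _ h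
    by_contra hij
    have hval := congrFun h i
    rw [Function.update_self, Function.update_of_ne hij, (Finset.mem_filter.1 hi).2] at hval
    exact one_ne_zero hval
  · intro b hb
    obtain ⟨i, hi, rfl⟩ := (covBy_iff_update _ _).1 (Finset.mem_filter.1 hb).2
    exact ⟨i, by simpa using hi, rfl⟩

lemma rk_eq_card (a : B n) : rk a = Finset.card {i | a i = 1} := by
  rw [rk, Finset.card_filter]
  have val_eq : ∀ x : Fin 2, (x : ℕ) = if x = 1 then 1 else 0 := by decide
  exact Finset.sum_congr rfl fun i _ => val_eq (a i)

lemma rk_le (a : B n) : rk a ≤ n := by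
  rw [rk_eq_card]
  exact (Finset.card_le_univ _).trans_eq (Fintype.card_fin n)

lemma sup_rk (n : ℕ) : Finset.univ.sup (rk : B n → ℕ) = n := by
  refine le_antisymm (Finset.sup_le fun a _ => rk_le a) ?_
  refine le_trans ?_ (Finset.le_sup (Finset.mem_univ (fun _ => 1 : B n)))
  simp [rk]

lemma le_of_mem_level {r : ℕ} {v : B n →₀ ℂ} (hv : v ≠ 0) (hr : v ∈ level rk r) : r ≤ n := by
  obtain ⟨a, ha⟩ := Finsupp.support_nonempty_iff.2 hv
  exact (hr ha : rk a = r) ▸ rk_le a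

lemma mem_level_iff {r : ℕ} {v : B n →₀ ℂ} : v ∈ level rk r ↔ shift 1 1 v = (r : ℂ) • v := by
  simp only [level, Finsupp.mem_supported', DFunLike.ext_iff, shift_self_apply,
    Finsupp.smul_apply, smul_eq_mul, mul_eq_mul_right_iff, Nat.cast_inj, Set.mem_ofPred_eq,
    rk_eq_card, or_iff_not_imp_left]

lemma shift_zero_zero_of_mem_level {r : ℕ} {v : B n →₀ ℂ} (hv : v ∈ level rk r) :
    shift 0 0 v = ((n : ℂ) - r) • v := by
  have h := sum_shift_self v
  rw [Fin.sum_univ_two, mem_level_iff.1 hv] at h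
  rw [sub_smul, ← h, add_sub_cancel_right]

lemma up_mem_level {r : ℕ} {v : B n →₀ ℂ} (hv : v ∈ level rk r) : up v ∈ level rk (r + 1) := by
  rw [mem_level_iff] at hv ⊢
  rw [shift_shift, hv]
  simp [add_smul]

lemma up_pow_mem_level {r : ℕ} {v : B n →₀ ℂ} (hv : v ∈ level rk r) (j : ℕ) :
    (up ^ j) v ∈ level rk (r + j) := by
  induction j with
  | zero => exact hv
  | succ j ih =>
    rw [pow_succ', Module.End.mul_apply]
    exact up_mem_level ih

lemma snocMap_mem_level (s : Fin 2) {r : ℕ} {v : B n →₀ ℂ} (hv : v ∈ level rk r) :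
    snocMap s v ∈ level (rk : B (n + 1) → ℕ) (r + s) := by
  rw [mem_level_iff] at hv ⊢
  rw [shift_snocMap, hv]
  fin_cases s <;> simp [add_smul]

lemma down_up {r : ℕ} {v : B n →₀ ℂ} (hv : v ∈ level rk r) :
    down (up v) = up (down v) + ((n : ℂ) - 2 * r) • v := by
  rw [shift_shift, if_pos rfl, if_pos rfl, shift_zero_zero_of_mem_level hv, mem_level_iff.1 hv,
    add_sub_assoc, ← sub_smul]
  congr 2
  ring

lemma down_up_pow {r : ℕ} {v : B n →₀ ℂ} (hr : v ∈ level rk r) (hv : down v = 0) (j : ℕ) :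
    down ((up ^ (j + 1)) v) = ((j + 1 : ℂ) * (n - 2 * r - j)) • (up ^ j) v := by
  induction j with
  | zero => simp [down_up hr, hv]
  | succ j ih =>
    rw [pow_succ', Module.End.mul_apply, down_up (up_pow_mem_level hr _), ih, map_smul,
      ← Module.End.mul_apply, ← pow_succ', ← add_smul]
    congr 1
    push_cast
    ring

lemma up_pow_eq_zero_iff {r : ℕ} {v : B n →₀ ℂ} (h0 : v ≠ 0) (hr : v ∈ level rk r)
    (hv : down v = 0) (j : ℕ) : (up ^ j) v = 0 ↔ n < 2 * r + j := by
  classical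
  have hex : ∃ j, (up ^ j) v = 0 := by
    refine ⟨n + 1, by_contra fun h => ?_⟩
    have := le_of_mem_level h (up_pow_mem_level hr (n + 1))
    omega
  obtain ⟨m, hm⟩ : ∃ m, Nat.find hex = m + 1 :=
    Nat.exists_eq_succ_of_ne_zero fun h => h0 ((Nat.find_eq_zero hex).1 h)
  have hlast : (up ^ (m + 1)) v = 0 := hm ▸ Nat.find_spec hex
  have hne : (up ^ m) v ≠ 0 := Nat.find_min hex (by omega)
  have hn : n = 2 * r + m := by
    have hcoeff := down_up_pow hr hv m
    rw [hlast, map_zero, eq_comm, smul_eq_zero_iff_left hne, mul_eq_zero, or_iff_right (by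
      exact_mod_cast m.succ_ne_zero)] at hcoeff
    have : (n : ℂ) = ((2 * r + m : ℕ) : ℂ) := by push_cast; linear_combination hcoeff
    exact_mod_cast this
  refine ⟨fun hj => ?_, fun hj => ?_⟩
  · have := Nat.find_min' hex hj
    omega
  · obtain ⟨i, rfl⟩ := Nat.exists_eq_add_of_le' (show m + 1 ≤ j by omega)
    rw [pow_add, Module.End.mul_apply, hlast, map_zero]

end Boolean

section PermRep

variable {n k : ℕ}

lemma permRep_single (π : Equiv.Perm (Fin n)) (a : MU n k) (c : ℂ) :
    permRep n k π (Finsupp.single a c) = Finsupp.single (fun i => a (π⁻¹ i) : MU n k) c :=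
  Finsupp.mapDomain_single

lemma permRep_apply (π : Equiv.Perm (Fin n)) (v : MU n k →₀ ℂ) (a : MU n k) :
    permRep n k π v a = v (fun i => a (π i)) := by
  conv_lhs => rw [show a = fun i => a (π (π⁻¹ i)) from
    funext fun i => congrArg (a : Fin n → Fin (k + 1)) (π.apply_symm_apply i).symm]
  exact Finsupp.mapDomain_apply (π⁻¹).surjective.injective_comp_right v fun i => a (π i)

lemma permRep_mem_level {r : ℕ} {v : MU n k →₀ ℂ} (hv : v ∈ level rk r)
    (π : Equiv.Perm (Fin n)) : permRep n k π v ∈ level rk r := by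
  rw [level, Finsupp.mem_supported'] at hv ⊢
  intro a ha
  rw [permRep_apply]
  exact hv _ fun hr => ha ((Equiv.sum_comp π fun i => (a i : ℕ)).symm.trans hr)

lemma stdInner_permRep (π : Equiv.Perm (Fin n)) (v w : MU n k →₀ ℂ) :
    stdInner (permRep n k π v) w = stdInner v (permRep n k π⁻¹ w) := by
  simp only [stdInner, permRep_apply]
  refine Fintype.sum_equiv (Equiv.arrowCongr π.symm (Equiv.refl (Fin (k + 1)))) _ _ fun a => ?_
  simp [Equiv.arrowCongr, Function.comp_def]

lemma permRep_shift (π : Equiv.Perm (Fin n)) (s t : Fin (k + 1)) (v : MU n k →₀ ℂ) :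
    permRep n k π (shift s t v) = shift s t (permRep n k π v) := by
  suffices h : permRep n k π ∘ₗ shift s t = shift s t ∘ₗ permRep n k π from
    LinearMap.congr_fun h v
  refine Finsupp.lhom_ext' fun a => LinearMap.ext_ring ?_
  simp only [LinearMap.comp_apply, Finsupp.lsingle_apply, shift_single, permRep_single, map_sum]
  refine Fintype.sum_equiv π _ _ fun i => ?_
  have hi : a (π⁻¹ (π i)) = a i := congrArg (a : Fin n → Fin (k + 1)) (π.symm_apply_apply i)
  rw [hi]
  split_ifs
  · rw [permRep_single]
    congr 1
    exact Function.update_comp_equiv a π⁻¹ i t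
  · rw [map_zero]

/-- The embedding of `S_n` into `S_(n+1)` as the stabilizer of the last letter. -/
def permCast (n : ℕ) : Equiv.Perm (Fin n) →* Equiv.Perm (Fin (n + 1)) :=
  Equiv.Perm.viaEmbeddingHom Fin.castSuccEmb

lemma permCast_castSucc (τ : Equiv.Perm (Fin n)) (i : Fin n) :
    permCast n τ i.castSucc = (τ i).castSucc :=
  τ.viaEmbedding_apply Fin.castSuccEmb i

lemma permCast_last (τ : Equiv.Perm (Fin n)) : permCast n τ (Fin.last n) = Fin.last n :=
  τ.viaEmbedding_apply_of_notMem Fin.castSuccEmb _ (by simp)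

lemma permCast_swap (i j : Fin n) :
    permCast n (Equiv.swap i j) = Equiv.swap i.castSucc j.castSucc := by
  ext l
  cases l using Fin.lastCases with
  | last =>
    rw [permCast_last, Equiv.swap_apply_of_ne_of_ne (Fin.castSucc_ne_last i).symm
      (Fin.castSucc_ne_last j).symm]
  | cast l => rw [permCast_castSucc, (Fin.castSucc_injective n).swap_apply]

lemma permRep_permCast_snocMap (τ : Equiv.Perm (Fin n)) (s : Fin (k + 1)) (v : MU n k →₀ ℂ) :
    permRep (n + 1) k (permCast n τ) (snocMap s v) = snocMap s (permRep n k τ v) := by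
  suffices h : permRep (n + 1) k (permCast n τ) ∘ₗ snocMap s = snocMap s ∘ₗ permRep n k τ from
    LinearMap.congr_fun h v
  refine Finsupp.lhom_ext fun a c => ?_
  simp only [LinearMap.comp_apply, snocMap_single, permRep_single, ← map_inv]
  congr 1
  funext i
  cases i using Fin.lastCases with
  | last => rw [permCast_last, Fin.snoc_last, Fin.snoc_last]
  | cast i => rw [permCast_castSucc, Fin.snoc_castSucc, Fin.snoc_castSucc]

end PermRep

section YJM

variable {n k : ℕ} {V : Type*} [AddCommGroup V] [Module ℂ V]

lemma yjm_apply (ρ : Representation ℂ (Equiv.Perm (Fin n)) V) (i : Fin n) (v : V) :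
    ρ.asAlgebraHom (yjm n i) v = ∑ j with j < i, ρ (Equiv.swap j i) v := by
  simp [yjm, map_sum, LinearMap.sum_apply]

lemma yjm_castSucc_apply (ρ : Representation ℂ (Equiv.Perm (Fin (n + 1))) V) (i : Fin n) (v : V) :
    ρ.asAlgebraHom (yjm (n + 1) i.castSucc) v =
      Representation.asAlgebraHom (ρ.comp (permCast n)) (yjm n i) v := by
  rw [yjm_apply, yjm_apply, Finset.sum_filter, Finset.sum_filter, Fin.sum_univ_castSucc]
  simp only [Fin.castSucc_lt_castSucc_iff, MonoidHom.comp_apply, permCast_swap]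
  rw [if_neg (not_lt.2 (Fin.le_last _)), add_zero]

lemma yjm_last_apply (ρ : Representation ℂ (Equiv.Perm (Fin (n + 1))) V) (v : V) :
    ρ.asAlgebraHom (yjm (n + 1) (Fin.last n)) v =
      ∑ j : Fin n, ρ (Equiv.swap j.castSucc (Fin.last n)) v := by
  rw [yjm_apply, Finset.sum_filter, Fin.sum_univ_castSucc]
  simp [Fin.castSucc_lt_last]

lemma map_yjm {W : Type*} [AddCommGroup W] [Module ℂ W]
    {ρ : Representation ℂ (Equiv.Perm (Fin n)) V} {σ : Representation ℂ (Equiv.Perm (Fin n)) W}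
    {φ : V →ₗ[ℂ] W} (h : ∀ π v, φ (ρ π v) = σ π (φ v)) (i : Fin n) (v : V) :
    φ (ρ.asAlgebraHom (yjm n i) v) = σ.asAlgebraHom (yjm n i) (φ v) := by
  simp only [yjm_apply, map_sum, h]

lemma mem_weightSpace_iff {ρ : Representation ℂ (Equiv.Perm (Fin n)) V} {α : Fin n → ℂ} {v : V} :
    v ∈ weightSpace ρ α ↔ ∀ i, ρ.asAlgebraHom (yjm n i) v = α i • v := by
  simp only [weightSpace, Submodule.mem_iInf, Module.End.mem_eigenspace_iff]

lemma map_mem_weightSpace {W : Type*} [AddCommGroup W] [Module ℂ W]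
    {ρ : Representation ℂ (Equiv.Perm (Fin n)) V} {σ : Representation ℂ (Equiv.Perm (Fin n)) W}
    {φ : V →ₗ[ℂ] W} (h : ∀ π v, φ (ρ π v) = σ π (φ v)) {α : Fin n → ℂ} {v : V}
    (hv : v ∈ weightSpace ρ α) : φ v ∈ weightSpace σ α := by
  rw [mem_weightSpace_iff] at hv ⊢
  exact fun i => by rw [← map_yjm h, hv, map_smul]

lemma yjm_castSucc_snocMap (i : Fin n) (s : Fin (k + 1)) (v : MU n k →₀ ℂ) :
    (permRep (n + 1) k).asAlgebraHom (yjm (n + 1) i.castSucc) (snocMap s v) =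
      snocMap s ((permRep n k).asAlgebraHom (yjm n i) v) := by
  rw [yjm_castSucc_apply]
  exact (map_yjm (fun τ v => (permRep_permCast_snocMap τ s v).symm) i v).symm

/-- On the last tensor factor `ℂ^(k+1)` the last Young–Jucys–Murphy element is the Casimir
tensor `∑ E_st ⊗ E_ts`. -/
lemma yjm_last_snocMap (s : Fin (k + 1)) (v : MU n k →₀ ℂ) :
    (permRep (n + 1) k).asAlgebraHom (yjm (n + 1) (Fin.last n)) (snocMap s v) =
      ∑ t, snocMap t (shift t s v) := by
  suffices h : (permRep (n + 1) k).asAlgebraHom (yjm (n + 1) (Fin.last n)) ∘ₗ snocMap s =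
      ∑ t, snocMap (n := n) t ∘ₗ shift t s by
    simpa using LinearMap.congr_fun h v
  have swap_snoc (a : MU n k) (j : Fin n) :
      permRep (n + 1) k (Equiv.swap j.castSucc (Fin.last n))
          (Finsupp.single (Fin.snoc a s : MU (n + 1) k) 1) =
        snocMap (a j) (Finsupp.single (Function.update a j s : MU n k) 1) := by
    rw [permRep_single, snocMap_single, Equiv.swap_inv]
    congr 1
    funext i
    cases i using Fin.lastCases with
    | last => simp
    | cast i =>
      obtain rfl | h := eq_or_ne i j
      · simp
      · rw [Equiv.swap_apply_of_ne_of_ne (by simpa using h) (Fin.castSucc_ne_last i)]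
        simp [h]
  refine Finsupp.lhom_ext' fun a => LinearMap.ext_ring ?_
  simp only [LinearMap.comp_apply, LinearMap.sum_apply, Finsupp.lsingle_apply, shift_single,
    snocMap_single, yjm_last_apply, swap_snoc, map_sum]
  rw [Finset.sum_comm]
  refine Finset.sum_congr rfl fun j _ => ?_
  simp only [apply_ite (snocMap _), map_zero, Finset.sum_ite_eq, Finset.mem_univ, if_true,
    snocMap_single]

lemma stdInner_yjm (i : Fin n) (v w : MU n k →₀ ℂ) :
    stdInner ((permRep n k).asAlgebraHom (yjm n i) v) w =
      stdInner v ((permRep n k).asAlgebraHom (yjm n i) w) := by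
  simp only [yjm_apply, ← stdForm_apply, map_sum, LinearMap.sum_apply]
  simp only [stdForm_apply, stdInner_permRep, Equiv.swap_inv]

lemma stdInner_eq_zero_of_weight_ne {α β : Fin n → ℂ} {v w : MU n k →₀ ℂ}
    (hv : v ∈ weightSpace (permRep n k) α) (hw : w ∈ weightSpace (permRep n k) β) (h : α ≠ β) :
    stdInner v w = 0 := by
  rw [mem_weightSpace_iff] at hv hw
  obtain ⟨i, hi⟩ := Function.ne_iff.1 h
  by_cases h0 : stdInner v v = 0
  · rw [stdInner_self_eq_zero.1 h0, ← stdForm_apply, map_zero, LinearMap.zero_apply]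
  · have hvv := stdInner_yjm i v v
    have hvw := stdInner_yjm i v w
    rw [hv, stdInner_smul_left, stdInner_smul_right] at hvv
    have hreal : conj (α i) = α i := mul_right_cancel₀ h0 hvv
    rw [hv, hw, stdInner_smul_left, stdInner_smul_right, hreal] at hvw
    exact (mul_eq_mul_right_iff.1 hvw).resolve_left hi

end YJM

section ChainBottoms

variable {n k : ℕ}

lemma eq_zero_of_snocMap_eq {s t : Fin (k + 1)} (hst : s ≠ t) {v w : MU n k →₀ ℂ}
    (h : snocMap s v = snocMap t w) : v = 0 := by
  ext a
  simpa only [snocMap_apply_snoc, if_true, if_neg hst.symm, Finsupp.zero_apply] using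
    DFunLike.congr_fun h (Fin.snoc a s : MU (n + 1) k)

lemma up_pow_snocMap_one (v : B n →₀ ℂ) (j : ℕ) :
    (up ^ j) (snocMap 1 v) = snocMap 1 ((up ^ j) v) := by
  induction j with
  | zero => rfl
  | succ j ih =>
    rw [pow_succ', Module.End.mul_apply, ih, shift_snocMap, if_neg one_ne_zero, add_zero, pow_succ',
      Module.End.mul_apply]

lemma up_pow_snocMap_zero (v : B n →₀ ℂ) (j : ℕ) :
    (up ^ j) (snocMap 0 v) =
      snocMap 0 ((up ^ j) v) + (j : ℂ) • snocMap 1 ((up ^ (j - 1)) v) := by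
  induction j with
  | zero => simp
  | succ j ih =>
    have hstep : (j : ℂ) • up ((up ^ (j - 1)) v) = (j : ℂ) • (up ^ j) v := by
      rcases j with _ | j
      · simp
      · rw [Nat.add_sub_cancel, pow_succ' up j, Module.End.mul_apply]
    rw [pow_succ', Module.End.mul_apply, ih, map_add, map_smul, shift_snocMap, shift_snocMap,
      if_pos rfl, if_neg one_ne_zero, add_zero, ← map_smul, hstep, pow_succ', Module.End.mul_apply,
      Nat.add_sub_cancel, map_smul]
    push_cast
    module

lemma up_pow_permRep (π : Equiv.Perm (Fin n)) (v : B n →₀ ℂ) (j : ℕ) :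
    (up ^ j) (permRep n 1 π v) = permRep n 1 π ((up ^ j) v) := by
  induction j with
  | zero => rfl
  | succ j ih => rw [pow_succ', Module.End.mul_apply, ih, Module.End.mul_apply, permRep_shift]

lemma mem_weightSpace_snoc_iff {α : Fin n → ℂ} {a : ℂ} {v : MU (n + 1) k →₀ ℂ} :
    v ∈ weightSpace (permRep (n + 1) k) (Fin.snoc α a) ↔
      (∀ i : Fin n, (permRep (n + 1) k).asAlgebraHom (yjm (n + 1) i.castSucc) v = α i • v) ∧
        (permRep (n + 1) k).asAlgebraHom (yjm (n + 1) (Fin.last n)) v = a • v := by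
  simp only [mem_weightSpace_iff, Fin.forall_fin_succ', Fin.snoc_castSucc, Fin.snoc_last]

lemma yjm_castSucc_snocMap_of_mem {α : Fin n → ℂ} {v : MU n k →₀ ℂ}
    (hv : v ∈ weightSpace (permRep n k) α) (s : Fin (k + 1)) (i : Fin n) :
    (permRep (n + 1) k).asAlgebraHom (yjm (n + 1) i.castSucc) (snocMap s v) =
      α i • snocMap s v := by
  rw [yjm_castSucc_snocMap, mem_weightSpace_iff.1 hv, map_smul]

end ChainBottoms

/-- A vector from which a symmetric Jordan chain of weight vectors of `V(B n)` starts: it is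
homogeneous, killed by the lowering operator, and a simultaneous eigenvector of the
Young–Jucys–Murphy elements. -/
structure ChainBottom (n : ℕ) where
  /-- The rank of the vector. -/
  rank : ℕ
  /-- The eigenvalues of the Young–Jucys–Murphy elements on the vector. -/
  weight : Fin n → ℂ
  /-- The vector itself. -/
  vec : B n →₀ ℂ
  vec_ne_zero : vec ≠ 0
  vec_mem_level : vec ∈ level rk rank
  down_vec : down vec = 0
  vec_mem_weightSpace : vec ∈ weightSpace (permRep n 1) weight

namespace ChainBottom

variable {n : ℕ} (t : ChainBottom n)

lemma up_pow_vec_mem_weightSpace (j : ℕ) :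
    (up ^ j) t.vec ∈ weightSpace (permRep n 1) t.weight :=
  map_mem_weightSpace (fun π v => up_pow_permRep π v j) t.vec_mem_weightSpace

lemma up_pow_vec_mem_level (j : ℕ) : (up ^ j) t.vec ∈ level rk (t.rank + j) :=
  up_pow_mem_level t.vec_mem_level j

lemma up_pow_vec_eq_zero_iff (j : ℕ) : (up ^ j) t.vec = 0 ↔ n < 2 * t.rank + j :=
  up_pow_eq_zero_iff t.vec_ne_zero t.vec_mem_level t.down_vec j

lemma two_mul_rank_le : 2 * t.rank ≤ n :=
  not_lt.1 fun h => t.vec_ne_zero ((t.up_pow_vec_eq_zero_iff 0).2 h)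

/-- The bottom of the longer of the two chains in the product of the chain of `t` with a chain
of two elements. -/
def long : ChainBottom (n + 1) where
  rank := t.rank
  weight := Fin.snoc t.weight (n - t.rank : ℂ)
  vec := snocMap 0 t.vec
  vec_ne_zero := (map_ne_zero_iff _ (snocMap_injective 0)).2 t.vec_ne_zero
  vec_mem_level := snocMap_mem_level 0 t.vec_mem_level
  down_vec := by simp [shift_snocMap, t.down_vec]
  vec_mem_weightSpace := by
    refine mem_weightSpace_snoc_iff.2 ⟨yjm_castSucc_snocMap_of_mem t.vec_mem_weightSpace 0, ?_⟩
    rw [yjm_last_snocMap, Fin.sum_univ_two, shift_zero_zero_of_mem_level t.vec_mem_level,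
      t.down_vec, map_zero, add_zero, map_smul]

/-- The bottom of the shorter of the two chains in the product of the chain of `t`, which has at
least two vectors, with a chain of two elements. -/
def short (ht : 2 * t.rank < n) : ChainBottom (n + 1) where
  rank := t.rank + 1
  weight := Fin.snoc t.weight (t.rank - 1 : ℂ)
  vec := (n - 2 * t.rank : ℂ) • snocMap 1 t.vec - snocMap 0 (up t.vec)
  vec_ne_zero h := by
    rw [sub_eq_zero, ← map_smul] at h
    refine t.vec_ne_zero ((smul_eq_zero_iff_right ?_).1 (eq_zero_of_snocMap_eq one_ne_zero h))
    rw [sub_ne_zero]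
    exact_mod_cast ht.ne'
  vec_mem_level :=
    Submodule.sub_mem _ (Submodule.smul_mem _ _ (snocMap_mem_level 1 t.vec_mem_level))
      (snocMap_mem_level 0 (up_mem_level t.vec_mem_level))
  down_vec := by
    rw [map_sub, map_smul, shift_snocMap, shift_snocMap, down_up t.vec_mem_level, t.down_vec]
    simp
  vec_mem_weightSpace := by
    refine mem_weightSpace_snoc_iff.2 ⟨fun i => ?_, ?_⟩
    · rw [map_sub, map_smul, yjm_castSucc_snocMap_of_mem t.vec_mem_weightSpace,
        yjm_castSucc_snocMap_of_mem (v := up t.vec) (t.up_pow_vec_mem_weightSpace 1),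
        smul_comm, ← smul_sub]
    · rw [map_sub, map_smul, yjm_last_snocMap, yjm_last_snocMap, Fin.sum_univ_two,
        Fin.sum_univ_two, shift_zero_zero_of_mem_level (up_mem_level t.vec_mem_level),
        mem_level_iff.1 t.vec_mem_level, down_up t.vec_mem_level, t.down_vec]
      simp only [map_zero, zero_add, map_smul]
      push_cast
      module

lemma up_pow_vec_long (j : ℕ) :
    (up ^ j) t.long.vec = snocMap 0 ((up ^ j) t.vec) + (j : ℂ) • snocMap 1 ((up ^ (j - 1)) t.vec) :=
  up_pow_snocMap_zero t.vec j

lemma up_pow_vec_short (ht : 2 * t.rank < n) (j : ℕ) :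
    (up ^ j) (t.short ht).vec =
      (n - 2 * t.rank - j : ℂ) • snocMap 1 ((up ^ j) t.vec) - snocMap 0 ((up ^ (j + 1)) t.vec) := by
  have hstep : (j : ℂ) • (up ^ (j - 1)) (up t.vec) = (j : ℂ) • (up ^ j) t.vec := by
    rcases j with _ | j
    · simp
    · rw [Nat.add_sub_cancel, pow_succ up j, Module.End.mul_apply]
  rw [short, map_sub, map_smul, up_pow_snocMap_one, up_pow_snocMap_zero, ← map_smul (snocMap 1),
    ← map_smul (snocMap 1), hstep, ← Module.End.mul_apply, ← pow_succ, map_smul, map_smul]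
  module

end ChainBottom

/-- The bottoms of the chains produced by the linear BTK algorithm on `B n`. -/
def bottoms : (n : ℕ) → List (ChainBottom n)
  | 0 =>
    [{  rank := 0
        weight := fun i => i.elim0
        vec := Finsupp.single (fun i => i.elim0) 1
        vec_ne_zero := Finsupp.single_ne_zero.2 one_ne_zero
        vec_mem_level := Finsupp.single_mem_supported _ _ rfl
        down_vec := by simp [shift_single]
        vec_mem_weightSpace := mem_weightSpace_iff.2 fun i => i.elim0 }]
  | n + 1 =>
    (bottoms n).flatMap fun t => if h : 2 * t.rank < n then [t.long, t.short h] else [t.long]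

lemma mem_bottoms_succ {n : ℕ} {t : ChainBottom (n + 1)} :
    t ∈ bottoms (n + 1) ↔ ∃ u ∈ bottoms n, t = u.long ∨ ∃ h : 2 * u.rank < n, t = u.short h := by
  rw [bottoms, List.mem_flatMap]
  refine exists_congr fun u => and_congr_right fun _ => ?_
  split_ifs with h <;> simp [h]

lemma two_add_weight_ne_zero {n : ℕ} {t : ChainBottom n} (ht : t ∈ bottoms n) (i : Fin n) :
    2 + t.weight i ≠ 0 := by
  induction n with
  | zero => exact i.elim0
  | succ n ih =>
    obtain ⟨u, hu, rfl | ⟨h, rfl⟩⟩ := mem_bottoms_succ.1 ht <;>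
      cases i using Fin.lastCases with
      | cast i => simpa [ChainBottom.long, ChainBottom.short] using ih hu i
      | last => ?_
    · obtain ⟨m, hm⟩ := Nat.exists_eq_add_of_le u.two_mul_rank_le
      have hpos : ((2 + u.rank + m : ℕ) : ℂ) ≠ 0 := Nat.cast_ne_zero.2 (by omega)
      convert hpos using 1
      have hn : (n : ℂ) = 2 * u.rank + m := by exact_mod_cast hm
      simp only [ChainBottom.long, Fin.snoc_last, hn]
      push_cast
      ring
    · have hpos : ((u.rank + 1 : ℕ) : ℂ) ≠ 0 := Nat.cast_ne_zero.2 (by omega)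
      convert hpos using 1
      simp only [ChainBottom.short, Fin.snoc_last]
      push_cast
      ring

lemma weight_long_ne_weight_short {n : ℕ} (t : ChainBottom n) (h : 2 * t.rank < n) :
    t.long.weight ≠ (t.short h).weight := by
  intro heq
  have hlast : (n - t.rank : ℂ) = t.rank - 1 := by
    simpa [ChainBottom.long, ChainBottom.short] using congrFun heq (Fin.last n)
  have : n + 1 = 2 * t.rank := by
    have : (n + 1 : ℂ) = 2 * t.rank := by linear_combination hlast
    exact_mod_cast this
  omega

lemma bottoms_pairwise_weight_ne (n : ℕ) :
    (bottoms n).Pairwise fun t u => t.weight ≠ u.weight := by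
  induction n with
  | zero => exact List.pairwise_singleton _ _
  | succ n ih =>
    have init_weight (t : ChainBottom n) (x) (hx : x ∈ if h : 2 * t.rank < n then
        [t.long, t.short h] else [t.long]) : (fun i : Fin n => x.weight i.castSucc) = t.weight := by
      have : x = t.long ∨ ∃ h, x = t.short h := by split_ifs at hx with h <;> simp_all
      obtain rfl | ⟨h, rfl⟩ := this <;>
        exact funext fun i => by simp [ChainBottom.long, ChainBottom.short]
    rw [bottoms, List.pairwise_flatMap]
    refine ⟨fun t _ => ?_, ih.imp fun {t u} htu x hx y hy hxy => htu ?_⟩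
    · split_ifs with h
      · exact List.pairwise_pair.2 (weight_long_ne_weight_short t h)
      · exact List.pairwise_singleton _ _
    · rw [← init_weight t x hx, ← init_weight u y hy, hxy]

lemma eq_of_weight_eq {n : ℕ} {t u : ChainBottom n} (ht : t ∈ bottoms n) (hu : u ∈ bottoms n)
    (h : t.weight = u.weight) : t = u := by
  have : Std.Symm fun t u : ChainBottom n => t.weight ≠ u.weight := ⟨fun _ _ => Ne.symm⟩
  by_contra hne
  exact (bottoms_pairwise_weight_ne n).forall ht hu hne h

section Algorithm

variable {n k : ℕ}

/-- The linear map `(i, j) ↦ x_i^(j)`, for a sequence of vectors `x`. It is `place` with lists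
replaced by sequences, which avoids types that depend on the length of a list. -/
def placeSeq (x : ℕ → (MU n k →₀ ℂ)) (p : ℕ) :
    (Fin (p + 1) × Fin (k + 1) →₀ ℂ) →ₗ[ℂ] (MU (n + 1) k →₀ ℂ) :=
  Finsupp.linearCombination ℂ fun y => snocMap y.2 (x y.1)

lemma placeSeq_single (x : ℕ → (MU n k →₀ ℂ)) (p : ℕ) (i : Fin (p + 1)) (s : Fin (k + 1))
    (c : ℂ) : placeSeq x p (Finsupp.single (i, s) c) = c • snocMap s (x i) :=
  Finsupp.linearCombination_single _ _ _

lemma map_place_eq_map_placeSeq (x : ℕ → (MU n k →₀ ℂ)) (p : ℕ) :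
    (btkTwo (((List.range (p + 1)).map x).length - 1) k).map
        (List.map (place (fun _ : Fin (n + 1) => k) ((List.range (p + 1)).map x))) =
      (btkTwo p k).map (List.map (placeSeq x p)) := by
  have hplace : ∀ (c : List (MU n k →₀ ℂ)) (q : ℕ), c.length - 1 = q →
      (∀ i ≤ q, c.getD i 0 = x i) →
      (btkTwo (c.length - 1) k).map (List.map (place (fun _ : Fin (n + 1) => k) c)) =
        (btkTwo q k).map (List.map (placeSeq x q)) := by
    rintro c q rfl hc
    suffices h : place (fun _ : Fin (n + 1) => k) c = placeSeq x (c.length - 1) by rw [h]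
    refine congrArg (Finsupp.linearCombination ℂ) (funext fun y => ?_)
    rw [hc y.1 (Nat.le_of_lt_succ y.1.isLt)]
  refine hplace _ p (by simp) fun i hi => ?_
  rw [List.getD_eq_getElem _ _ (by simpa using Nat.lt_succ_of_le hi)]
  simp

lemma placeSeq_mainVec (x : ℕ → (MU n k →₀ ℂ)) (p m : ℕ) (hx : ∀ i, p < i → x i = 0) :
    placeSeq x p (mainVec p k m) =
      ∑ s : Fin (k + 1), (m.choose s : ℂ) • snocMap s (x (m - s)) := by
  rw [mainVec, map_sum, Fintype.sum_prod_type_right]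
  refine Finset.sum_congr rfl fun s _ => ?_
  simp only [apply_ite (placeSeq x p), map_zero, placeSeq_single]
  rcases lt_or_ge m s with hs | hs
  · rw [Nat.choose_eq_zero_of_lt hs, Nat.cast_zero, zero_smul]
    exact Finset.sum_eq_zero fun i _ => if_neg (by omega)
  rcases lt_or_ge p (m - s) with hp | hp
  · rw [hx _ hp, map_zero, smul_zero]
    exact Finset.sum_eq_zero fun i _ => if_neg (by omega)
  · rw [Fintype.sum_eq_single (⟨m - s, Nat.lt_succ_of_le hp⟩ : Fin (p + 1)) fun i hi =>
      if_neg fun h => hi (Fin.ext (by simp only; omega)), if_pos (by simp only; omega),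
      Nat.choose_symm hs]

lemma placeSeq_transfer (x : ℕ → (MU n (k + 1) →₀ ℂ)) (p : ℕ) (i : Fin (p + 1))
    (s : Fin (k + 1)) :
    placeSeq x (p + 1) (transfer p k (Finsupp.single (i, s) 1)) =
      (p + 1 - i : ℂ) • snocMap s.succ (x i) -
        (k + 1 - s : ℂ) • snocMap s.castSucc (x (i + 1)) := by
  rw [transfer, Finsupp.linearCombination_single, one_smul, map_sub, placeSeq_single,
    placeSeq_single]
  rfl

lemma btkTwo_zero_right (p : ℕ) :
    btkTwo p 0 = [List.ofFn fun i : Fin (p + 1) => Finsupp.single (i, 0) 1] := by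
  cases p with
  | zero => simp [btkTwo]
  | succ p => rfl

end Algorithm

namespace ChainBottom

variable {n : ℕ} (t : ChainBottom n)

/-- The symmetric Jordan chain starting from the vector of `t`. -/
def chain : List (B n →₀ ℂ) := (List.range (n - 2 * t.rank + 1)).map fun j => (up ^ j) t.vec

lemma placeSeq_mainVec_eq_up_pow_long {p : ℕ} (hp : n - 2 * t.rank = p) (m : ℕ) :
    placeSeq (fun j => (up ^ j) t.vec) p (mainVec p 1 m) = (up ^ m) t.long.vec := by
  rw [placeSeq_mainVec _ _ _ fun i hi => (t.up_pow_vec_eq_zero_iff i).2 (by omega),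
    Fin.sum_univ_two, t.up_pow_vec_long]
  simp

lemma placeSeq_transfer_eq_up_pow_short (h : 2 * t.rank < n) {p : ℕ}
    (hp : n - 2 * t.rank = p + 1) (i : Fin (p + 1)) :
    placeSeq (fun j => (up ^ j) t.vec) (p + 1) (transfer p 0 (Finsupp.single (i, 0) 1)) =
      (up ^ (i : ℕ)) (t.short h).vec := by
  have hn : (n : ℂ) = 2 * t.rank + (p + 1) := by
    exact_mod_cast (by omega : n = 2 * t.rank + (p + 1))
  rw [placeSeq_transfer, up_pow_vec_short, hn]
  simp

lemma btkTwo_map_place_chain :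
    (btkTwo (t.chain.length - 1) 1).map (List.map (place (fun _ : Fin (n + 1) => 1) t.chain)) =
      (if h : 2 * t.rank < n then [t.long, t.short h] else [t.long]).map chain := by
  rw [chain, map_place_eq_map_placeSeq]
  obtain ⟨p, hp⟩ : ∃ p, n - 2 * t.rank = p := ⟨_, rfl⟩
  rw [hp]
  cases p with
  | zero =>
    have hlen : n + 1 - 2 * t.rank + 1 = 2 := by have := t.two_mul_rank_le; omega
    have hup : up t.vec = 0 := (t.up_pow_vec_eq_zero_iff 1).2 (by omega)
    rw [dif_neg (by omega)]
    simp only [btkTwo, List.map_singleton, chain, long, hlen, List.map_ofFn]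
    simp [List.ofFn_succ, List.range_succ, placeSeq_single, shift_snocMap, hup]
  | succ p =>
    have h : 2 * t.rank < n := by omega
    have hlong : n + 1 - 2 * t.long.rank = p + 2 := by simp only [long]; omega
    have hshort : n + 1 - 2 * (t.short h).rank = p := by simp only [short]; omega
    simp only [dif_pos h, btkTwo, btkTwo_zero_right, List.map_cons, List.map_nil, chain, hlong,
      hshort, List.map_map, List.map_ofFn]
    congr 1
    · exact List.map_congr_left fun m _ => t.placeSeq_mainVec_eq_up_pow_long hp m
    · congr 1
      refine List.ext_getElem (by simp) fun i hi _ => ?_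
      simp only [List.getElem_ofFn, Function.comp_apply, List.getElem_map, List.getElem_range]
      exact t.placeSeq_transfer_eq_up_pow_short h hp _

end ChainBottom

lemma O_eq_map_chain (n : ℕ) : O n = (bottoms n).map ChainBottom.chain := by
  induction n with
  | zero => simp [O, linearBTK, bottoms, ChainBottom.chain]
  | succ n ih =>
    have hO : O (n + 1) = (O n).flatMap fun c =>
        (btkTwo (c.length - 1) 1).map (List.map (place (fun _ : Fin (n + 1) => 1) c)) := rfl
    rw [hO, ih, bottoms, List.flatMap_map, List.map_flatMap]
    exact List.flatMap_congr fun t _ => t.btkTwo_map_place_chain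

section JordanBasis

variable {n : ℕ}

namespace ChainBottom

lemma up_pow_vec_ne_zero (t : ChainBottom n) {j : ℕ} (hj : 2 * t.rank + j ≤ n) :
    (up ^ j) t.vec ≠ 0 := fun h => hj.not_gt ((t.up_pow_vec_eq_zero_iff j).1 h)

lemma weight_eq_of_mem (t : ChainBottom n) {j : ℕ} (hj : 2 * t.rank + j ≤ n) {α : Fin n → ℂ}
    (hα : (up ^ j) t.vec ∈ weightSpace (permRep n 1) α) : t.weight = α := by
  by_contra h
  exact t.up_pow_vec_ne_zero hj (stdInner_self_eq_zero.1
    (stdInner_eq_zero_of_weight_ne (t.up_pow_vec_mem_weightSpace j) hα h))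

lemma mem_chain_iff (t : ChainBottom n) {v : B n →₀ ℂ} :
    v ∈ t.chain ↔ ∃ j, 2 * t.rank + j ≤ n ∧ (up ^ j) t.vec = v := by
  have := t.two_mul_rank_le
  simp only [chain, List.mem_map, List.mem_range]
  exact exists_congr fun _ => and_congr_left fun _ => by omega

lemma chain_pairwise (t : ChainBottom n) : t.chain.Pairwise fun v w => stdInner v w = 0 :=
  List.pairwise_lt_range.map _ fun {i j} hij =>
    stdInner_eq_zero_of_level_ne (t.up_pow_vec_mem_level i) (t.up_pow_vec_mem_level j) (by omega)

lemma isSymmetricJordanChain_chain (t : ChainBottom n) : IsSymmetricJordanChain rk t.chain := by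
  have hne : t.chain ≠ [] := by simp [chain]
  have hhead : t.chain.head hne = t.vec := by simp [chain, List.head_eq_getElem]
  have hlast : t.chain.getLast hne = (up ^ (n - 2 * t.rank)) t.vec := by
    simp [chain, List.getLast_eq_getElem]
  refine ⟨hne, fun v hv => ?_, fun v hv => ?_, ?_, ?_,
    t.rank, t.rank + (n - 2 * t.rank), ?_, ?_, ?_⟩
  · obtain ⟨j, hj, rfl⟩ := t.mem_chain_iff.1 hv
    exact t.up_pow_vec_ne_zero hj
  · obtain ⟨j, -, rfl⟩ := t.mem_chain_iff.1 hv
    exact ⟨_, t.up_pow_vec_mem_level j⟩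
  · rw [List.isChain_iff_getElem]
    intro i hi
    simp only [chain, List.getElem_map, List.getElem_range]
    rw [upOp_eq_up, pow_succ', Module.End.mul_apply]
  · rw [hlast, upOp_eq_up, ← Module.End.mul_apply, ← pow_succ', t.up_pow_vec_eq_zero_iff]
    omega
  · exact hhead ▸ t.vec_mem_level
  · exact hlast ▸ t.up_pow_vec_mem_level _
  · have := t.two_mul_rank_le
    rw [sup_rk]
    omega

end ChainBottom

lemma mem_vectors_O_iff {v : B n →₀ ℂ} :
    v ∈ vectors (O n) ↔ ∃ t ∈ bottoms n, ∃ j, 2 * t.rank + j ≤ n ∧ (up ^ j) t.vec = v := by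
  rw [O_eq_map_chain]
  simp only [vectors, Set.mem_ofPred_eq, List.mem_map, exists_exists_and_eq_and,
    ChainBottom.mem_chain_iff]

lemma flatten_O_pairwise (n : ℕ) : (O n).flatten.Pairwise fun v w => stdInner v w = 0 := by
  rw [O_eq_map_chain, List.pairwise_flatten]
  refine ⟨fun c hc => ?_, (bottoms_pairwise_weight_ne n).map _ fun {t u} htu v hv w hw => ?_⟩
  · obtain ⟨t, -, rfl⟩ := List.mem_map.1 hc
    exact t.chain_pairwise
  · obtain ⟨i, -, rfl⟩ := t.mem_chain_iff.1 hv
    obtain ⟨j, -, rfl⟩ := u.mem_chain_iff.1 hw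
    exact stdInner_eq_zero_of_weight_ne (t.up_pow_vec_mem_weightSpace i)
      (u.up_pow_vec_mem_weightSpace j) htu

lemma mem_flatten_iff {V : Type*} {L : List (List V)} {v : V} : v ∈ L.flatten ↔ v ∈ vectors L :=
  List.mem_flatten

lemma vectors_O_pairwise (n : ℕ) : (vectors (O n)).Pairwise fun v w => stdInner v w = 0 :=
  fun _ hv _ hw hvw =>
    (flatten_O_pairwise n).forall (mem_flatten_iff.2 hv) (mem_flatten_iff.2 hw) hvw

lemma ne_zero_of_mem_vectors_O {v : B n →₀ ℂ} (hv : v ∈ vectors (O n)) : v ≠ 0 := by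
  obtain ⟨t, -, j, hj, rfl⟩ := mem_vectors_O_iff.1 hv
  exact t.up_pow_vec_ne_zero hj

lemma linearIndependent_flatten_O (n : ℕ) : LinearIndependent ℂ (O n).flatten.get :=
  linearIndependent_get_of_orthogonal
    (fun _ hv => ne_zero_of_mem_vectors_O (mem_flatten_iff.1 hv)) (flatten_O_pairwise n)

lemma sum_chain_length (n : ℕ) :
    ((bottoms n).map fun t => n - 2 * t.rank + 1).sum = 2 ^ n := by
  induction n with
  | zero => rfl
  | succ n ih =>
    have hstep (t : ChainBottom n) : ((if h : 2 * t.rank < n then [t.long, t.short h]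
        else [t.long]).map fun u => n + 1 - 2 * u.rank + 1).sum = 2 * (n - 2 * t.rank + 1) := by
      have := t.two_mul_rank_le
      split_ifs <;> simp [ChainBottom.long, ChainBottom.short] <;> omega
    rw [bottoms, List.map_flatMap, List.flatMap, List.sum_flatten, List.map_map]
    simp only [Function.comp_def, hstep]
    rw [List.sum_map_mul_left, ih, pow_succ']

lemma length_flatten_O (n : ℕ) : (O n).flatten.length = 2 ^ n := by
  rw [← sum_chain_length, O_eq_map_chain, List.length_flatten, List.map_map]
  congr 2
  funext t
  simp [ChainBottom.chain]

lemma span_vectors_O (n : ℕ) : Submodule.span ℂ (vectors (O n)) = ⊤ := by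
  have hrange : Set.range (O n).flatten.get = vectors (O n) := by
    rw [Set.range_list_get]
    exact Set.ext fun v => mem_flatten_iff
  rw [← hrange]
  refine (linearIndependent_flatten_O n).span_eq_top_of_card_eq_finrank' ?_
  rw [Fintype.card_fin, length_flatten_O, Module.finrank_finsupp_self]
  simp

lemma isSJB_O (n : ℕ) : IsSJB rk (O n) where
  chains c hc := by
    rw [O_eq_map_chain] at hc
    obtain ⟨t, -, rfl⟩ := List.mem_map.1 hc
    exact t.isSymmetricJordanChain_chain
  linearIndependent := linearIndependent_flatten_O n
  span_eq_top := span_vectors_O n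

lemma span_vectors_O_inter_level (r : ℕ) :
    Submodule.span ℂ (vectors (O n) ∩ (level rk r : Submodule ℂ (B n →₀ ℂ))) = level rk r := by
  refine le_antisymm (Submodule.span_le.2 Set.inter_subset_right) fun v hv => ?_
  refine mem_span_of_stdInner_eq_zero (span_vectors_O n) (vectors_O_pairwise n) fun x hx hxr => ?_
  obtain ⟨t, -, j, -, rfl⟩ := mem_vectors_O_iff.1 hx
  refine stdInner_eq_zero_of_level_ne (t.up_pow_vec_mem_level j) hv ?_
  rintro rfl
  exact hxr (t.up_pow_vec_mem_level j)

lemma span_vectors_O_inter_weightSpace (α : Fin n → ℂ) :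
    Submodule.span ℂ (vectors (O n) ∩ weightSpace (permRep n 1) α) =
      weightSpace (permRep n 1) α := by
  refine le_antisymm (Submodule.span_le.2 Set.inter_subset_right) fun v hv => ?_
  refine mem_span_of_stdInner_eq_zero (span_vectors_O n) (vectors_O_pairwise n) fun x hx hxα => ?_
  obtain ⟨t, -, j, -, rfl⟩ := mem_vectors_O_iff.1 hx
  refine stdInner_eq_zero_of_weight_ne (t.up_pow_vec_mem_weightSpace j) hv ?_
  rintro rfl
  exact hxα (t.up_pow_vec_mem_weightSpace j)

lemma exists_weight_eq_of_weightSpace_ne_bot {α : Fin n → ℂ}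
    (h : weightSpace (permRep n 1) α ≠ ⊥) : ∃ t ∈ bottoms n, t.weight = α := by
  rw [← span_vectors_O_inter_weightSpace, Ne, Submodule.span_eq_bot] at h
  push Not at h
  obtain ⟨x, ⟨hx, hxα⟩, -⟩ := h
  obtain ⟨t, ht, j, hj, rfl⟩ := mem_vectors_O_iff.1 hx
  exact ⟨t, ht, t.weight_eq_of_mem hj hxα⟩

lemma weightSpace_eq_span_range {t : ChainBottom n} (ht : t ∈ bottoms n) :
    weightSpace (permRep n 1) t.weight =
      Submodule.span ℂ (Set.range fun j : Fin (n - 2 * t.rank + 1) => (up ^ (j : ℕ)) t.vec) := by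
  refine le_antisymm ?_ (Submodule.span_le.2 ?_)
  · rw [← span_vectors_O_inter_weightSpace]
    refine Submodule.span_mono ?_
    rintro x ⟨hx, hxα⟩
    obtain ⟨u, hu, j, hj, rfl⟩ := mem_vectors_O_iff.1 hx
    obtain rfl := eq_of_weight_eq hu ht (u.weight_eq_of_mem hj hxα)
    exact ⟨⟨j, by omega⟩, rfl⟩
  · rintro _ ⟨j, rfl⟩
    exact t.up_pow_vec_mem_weightSpace j

lemma exists_eq_smul_up_pow_vec {α : Fin n → ℂ} {r : ℕ} {v : B n →₀ ℂ} (h0 : v ≠ 0)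
    (hr : v ∈ level rk r) (hα : v ∈ weightSpace (permRep n 1) α) :
    ∃ t ∈ bottoms n, t.weight = α ∧
      ∃ j, 2 * t.rank + j ≤ n ∧ ∃ c : ℂ, c ≠ 0 ∧ v = c • (up ^ j) t.vec := by
  obtain ⟨t, ht, rfl⟩ := exists_weight_eq_of_weightSpace_ne_bot (Submodule.ne_bot_iff _ |>.2
    ⟨v, hα, h0⟩)
  have hspan : v ∈ Submodule.span ℂ {(up ^ (r - t.rank)) t.vec} := by
    refine Submodule.span_mono ?_ (mem_span_of_stdInner_eq_zero (span_vectors_O n)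
      (vectors_O_pairwise n)
      (T := {x | x ∈ level rk r ∧ x ∈ weightSpace (permRep n 1) t.weight}) ?_)
    · rintro x ⟨hx, hxr, hxα⟩
      obtain ⟨u, hu, j, hj, rfl⟩ := mem_vectors_O_iff.1 hx
      obtain rfl := eq_of_weight_eq hu ht (u.weight_eq_of_mem hj hxα)
      obtain rfl := level_unique (u.up_pow_vec_ne_zero hj) (u.up_pow_vec_mem_level j) hxr
      simp
    · intro x hx hxT
      obtain ⟨u, -, j, -, rfl⟩ := mem_vectors_O_iff.1 hx
      by_cases hur : u.rank + j = r
      · refine stdInner_eq_zero_of_weight_ne (u.up_pow_vec_mem_weightSpace j) hα fun h => hxT ?_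
        exact ⟨hur ▸ u.up_pow_vec_mem_level j, h ▸ u.up_pow_vec_mem_weightSpace j⟩
      · exact stdInner_eq_zero_of_level_ne (u.up_pow_vec_mem_level j) hr hur
  obtain ⟨c, rfl⟩ := Submodule.mem_span_singleton.1 hspan
  obtain ⟨hc, hv⟩ := smul_ne_zero_iff.1 h0
  exact ⟨t, ht, rfl, _, not_lt.1 fun h => hv ((t.up_pow_vec_eq_zero_iff _).2 h), c, hc, rfl⟩

end JordanBasis

section Irreducible

variable {m n : ℕ} {V W : Type*} [AddCommGroup V] [Module ℂ V] [AddCommGroup W] [Module ℂ W]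
  {ρ : Representation ℂ (Equiv.Perm (Fin n)) V} {σ : Representation ℂ (Equiv.Perm (Fin m)) W}
  {H : Subgroup (Equiv.Perm (Fin n))} {φ : V →ₗ[ℂ] W}

/-- The `H`-submodule generated by `v`; for `H = ⊤` it is `cyclic ρ v`. -/
def orbitSpan (ρ : Representation ℂ (Equiv.Perm (Fin n)) V)
    (H : Subgroup (Equiv.Perm (Fin n))) (v : V) : Submodule ℂ V :=
  Submodule.span ℂ ((fun π => ρ π v) '' H)

lemma orbitSpan_top (v : V) : orbitSpan ρ ⊤ v = cyclic ρ v := by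
  simp [orbitSpan, cyclic]

lemma mem_orbitSpan_self (v : V) : v ∈ orbitSpan ρ H v :=
  Submodule.subset_span ⟨1, H.one_mem, by simp⟩

lemma mem_cyclic_self (v : V) : v ∈ cyclic ρ v :=
  orbitSpan_top (ρ := ρ) v ▸ mem_orbitSpan_self v

lemma orbitSpan_mono {K : Subgroup (Equiv.Perm (Fin n))} (h : H ≤ K) (v : V) :
    orbitSpan ρ H v ≤ orbitSpan ρ K v :=
  Submodule.span_mono (Set.image_mono h)

lemma cyclic_le {S : Submodule ℂ V} (hS : IsInvariant ρ ⊤ S) {v : V} (hv : v ∈ S) :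
    cyclic ρ v ≤ S :=
  Submodule.span_le.2 (Set.range_subset_iff.2 fun π => hS π trivial v hv)

lemma isInvariant_cyclic (v : V) : IsInvariant ρ ⊤ (cyclic ρ v) := by
  intro π _
  refine (Submodule.span_le (p := (cyclic ρ v).comap (ρ π))).2 (Set.range_subset_iff.2 fun τ => ?_)
  exact Submodule.subset_span ⟨π * τ, by simp⟩

lemma map_orbitSpan {f : Equiv.Perm (Fin n) →* Equiv.Perm (Fin m)}
    (hφ : ∀ π v, φ (ρ π v) = σ (f π) (φ v)) (v : V) :
    (orbitSpan ρ H v).map φ = orbitSpan σ (H.map f) (φ v) := by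
  simp only [orbitSpan, Submodule.map_span, Subgroup.coe_map, Set.image_image, hφ]

lemma IsInvariant.comap {f : Equiv.Perm (Fin n) →* Equiv.Perm (Fin m)}
    (hφ : ∀ π v, φ (ρ π v) = σ (f π) (φ v)) {N : Submodule ℂ W}
    (hN : IsInvariant σ (H.map f) N) : IsInvariant ρ H (N.comap φ) := fun π hπ v hv => by
  rw [Submodule.mem_comap, hφ]
  exact hN _ (Subgroup.mem_map_of_mem f hπ) _ hv

lemma IsInvariant.map {f : Equiv.Perm (Fin n) →* Equiv.Perm (Fin m)}
    (hφ : ∀ π v, φ (ρ π v) = σ (f π) (φ v)) {N : Submodule ℂ V} (hN : IsInvariant ρ H N) :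
    IsInvariant σ (H.map f) (N.map φ) := by
  rintro _ ⟨π, hπ, rfl⟩ _ ⟨v, hv, rfl⟩
  exact ⟨_, hN π hπ v hv, hφ π v⟩

namespace IsIrreducibleSub

variable {L : Submodule ℂ V}

lemma le_or_disjoint (hL : IsIrreducibleSub ρ H L) {N : Submodule ℂ V}
    (hN : IsInvariant ρ H N) : L ≤ N ∨ Disjoint L N :=
  (hL.eq_bot_or_eq (L ⊓ N) inf_le_left fun π hπ v hv =>
    ⟨hL.invariant π hπ v hv.1, hN π hπ v hv.2⟩).symm.imp inf_eq_left.1 disjoint_iff.2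

lemma map {f : Equiv.Perm (Fin n) →* Equiv.Perm (Fin m)}
    (hφ : ∀ π v, φ (ρ π v) = σ (f π) (φ v)) (hL : IsIrreducibleSub ρ H L) (h0 : L.map φ ≠ ⊥) :
    IsIrreducibleSub σ (H.map f) (L.map φ) where
  invariant := hL.invariant.map hφ
  ne_bot := h0
  eq_bot_or_eq N hN hinv := by
    refine (hL.le_or_disjoint (hinv.comap hφ)).symm.imp (fun h => ?_) fun h => ?_
    · refine (Submodule.eq_bot_iff _).2 fun w hw => ?_
      obtain ⟨v, hv, rfl⟩ := hN hw
      rw [Submodule.disjoint_def.1 h v hv hw, map_zero]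
    · exact le_antisymm hN (Submodule.map_le_iff_le_comap.2 h)

lemma map_orbitSpan_of_ne_zero {f : Equiv.Perm (Fin n) →* Equiv.Perm (Fin m)}
    (hφ : ∀ π v, φ (ρ π v) = σ (f π) (φ v)) {v : V} (hv : IsIrreducibleSub ρ H (orbitSpan ρ H v))
    (h0 : φ v ≠ 0) : IsIrreducibleSub σ (H.map f) (orbitSpan σ (H.map f) (φ v)) := by
  rw [← map_orbitSpan hφ]
  refine hv.map hφ (Submodule.ne_bot_iff _ |>.2 ⟨φ v, ?_, h0⟩)
  exact Submodule.mem_map_of_mem (mem_orbitSpan_self v)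

lemma cyclic_eq (hL : IsIrreducibleSub ρ ⊤ L) {v : V} (hv : v ∈ L) (h0 : v ≠ 0) :
    cyclic ρ v = L :=
  (hL.eq_bot_or_eq _ (cyclic_le hL.invariant hv) (isInvariant_cyclic v)).resolve_left
    (Submodule.ne_bot_iff _ |>.2 ⟨v, mem_cyclic_self v, h0⟩)

lemma exists_apply_eq_smul [FiniteDimensional ℂ L] (hL : IsIrreducibleSub ρ H L)
    {f : Module.End ℂ V} (hmem : ∀ v ∈ L, f v ∈ L)
    (hf : ∀ π ∈ H, ∀ v, f (ρ π v) = ρ π (f v)) : ∃ c : ℂ, ∀ v ∈ L, f v = c • v := by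
  have : Nontrivial L := Submodule.nontrivial_iff_ne_bot.2 hL.ne_bot
  obtain ⟨c, hc⟩ := Module.End.exists_eigenvalue (f.restrict hmem)
  obtain ⟨w, hw⟩ := hc.exists_hasEigenvector
  have hinv : IsInvariant ρ H (f.eigenspace c) := fun π hπ v hv => by
    rw [Module.End.mem_eigenspace_iff] at hv ⊢
    rw [hf π hπ, hv, map_smul]
  refine ⟨c, fun v hv => ?_⟩
  rcases hL.le_or_disjoint hinv with h | h
  · exact Module.End.mem_eigenspace_iff.1 (h hv)
  · have hwc : (w : V) ∈ f.eigenspace c :=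
      Module.End.mem_eigenspace_iff.2 (congrArg Subtype.val hw.apply_eq_smul)
    exact absurd (Subtype.ext (Submodule.disjoint_def.1 h w w.2 hwc)) hw.2

end IsIrreducibleSub

lemma IsInvariant.exists_isCompl {S : Submodule ℂ V} (hS : IsInvariant ρ ⊤ S) :
    ∃ T, IsInvariant ρ ⊤ T ∧ IsCompl S T := by
  obtain ⟨T, hT⟩ := ComplementedLattice.exists_isCompl
    (⟨S, fun π _ => hS π trivial _⟩ : Subrepresentation ρ)
  refine ⟨T.toSubmodule, fun π _ v hv => T.apply_mem_toSubmodule π hv, ?_, ?_⟩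
  · rw [disjoint_iff]
    exact congrArg Subrepresentation.toSubmodule hT.inf_eq_bot
  · rw [codisjoint_iff]
    exact congrArg Subrepresentation.toSubmodule hT.sup_eq_top

lemma IsInvariant.yjm_mem {S : Submodule ℂ V} (hS : IsInvariant ρ ⊤ S) (i : Fin n) {v : V}
    (hv : v ∈ S) : ρ.asAlgebraHom (yjm n i) v ∈ S := by
  rw [yjm_apply]
  exact S.sum_mem fun j _ => hS _ trivial v hv

/-- The components of `v` in an invariant decomposition have the weight of `v`, so a submodule of
`ℂ[S_n] v` is trivial when `v` spans its weight space there. -/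
lemma isIrreducibleSub_cyclic {α : Fin n → ℂ} {v : V} (h0 : v ≠ 0) (hv : v ∈ weightSpace ρ α)
    (h : cyclic ρ v ⊓ weightSpace ρ α ≤ Submodule.span ℂ {v}) :
    IsIrreducibleSub ρ ⊤ (cyclic ρ v) where
  invariant := isInvariant_cyclic v
  ne_bot := Submodule.ne_bot_iff _ |>.2 ⟨v, mem_cyclic_self v, h0⟩
  eq_bot_or_eq S hS hinv := by
    obtain ⟨T, hT, hST⟩ := hinv.exists_isCompl
    obtain ⟨s, hs, t, ht, rfl⟩ :=
      Submodule.mem_sup.1 (hST.sup_eq_top ▸ Submodule.mem_top : v ∈ S ⊔ T)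
    have hsα : s ∈ weightSpace ρ α := mem_weightSpace_iff.2 fun i => by
      have hi := mem_weightSpace_iff.1 hv i
      rw [map_add, smul_add] at hi
      have hsub : ρ.asAlgebraHom (yjm n i) s - α i • s = α i • t - ρ.asAlgebraHom (yjm n i) t := by
        rw [sub_eq_sub_iff_add_eq_add, hi, add_comm]
      refine sub_eq_zero.1 (Submodule.disjoint_def.1 hST.disjoint _
        (S.sub_mem (hinv.yjm_mem i hs) (S.smul_mem _ hs)) ?_)
      exact hsub ▸ T.sub_mem (T.smul_mem _ ht) (hT.yjm_mem i ht)
    obtain ⟨c, hc⟩ := Submodule.mem_span_singleton.1 (h ⟨hS hs, hsα⟩)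
    obtain rfl | hc0 := eq_or_ne c 0
    · left
      obtain rfl : s = 0 := by rw [← hc, zero_smul]
      rw [zero_add] at hS
      exact hST.disjoint.eq_bot_of_le (hS.trans (cyclic_le hT ht))
    · right
      refine le_antisymm hS (cyclic_le hinv ?_)
      rw [← inv_smul_smul₀ hc0 (s + t), hc]
      exact S.smul_mem _ hs

end Irreducible

section Young

variable {n : ℕ}

lemma bijective_permCast_mul_swap (n : ℕ) :
    Function.Bijective fun x : Equiv.Perm (Fin n) × Fin (n + 1) =>
      permCast n x.1 * Equiv.swap x.2 (Fin.last n) := by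
  refine (Fintype.bijective_iff_injective_and_card _).2 ⟨?_, ?_⟩
  · rintro ⟨τ, i⟩ ⟨π, j⟩ h
    have hlast (τ : Equiv.Perm (Fin n)) (i : Fin (n + 1)) :
        (permCast n τ * Equiv.swap i (Fin.last n)) i = Fin.last n := by
      simp [permCast_last]
    obtain rfl : i = j := by
      refine (permCast n τ * Equiv.swap i (Fin.last n)).injective ((hlast τ i).trans ?_)
      exact (hlast π j).symm.trans (congrArg (fun σ => σ j) h).symm
    exact congrArg (·, i) (Equiv.Perm.viaEmbeddingHom_injective _ (mul_right_cancel h))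
  · simp [Fintype.card_perm, Nat.factorial_succ, mul_comm]

lemma youngSub_succ_eq_map {i : ℕ} (hi : i ≤ n) :
    youngSub (n + 1) i = (youngSub n i).map (permCast n) := by
  ext σ
  constructor
  · intro hσ
    obtain ⟨⟨τ, j⟩, rfl⟩ := (bijective_permCast_mul_swap n).2 σ
    have hlast := hσ (Fin.last n) (by simpa using hi)
    obtain rfl : j = Fin.last n := by
      simpa [Equiv.swap_apply_right] using
        (permCast n τ).injective (hlast.trans (permCast_last τ).symm)
    refine ⟨τ, fun k hk => ?_, by simp [← Equiv.Perm.one_def]⟩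
    simpa [permCast_castSucc] using hσ k.castSucc (by simpa using hk)
  · rintro ⟨τ, hτ, rfl⟩ j hj
    cases j using Fin.lastCases with
    | last => exact permCast_last τ
    | cast j => rw [permCast_castSucc, hτ j (by simpa using hj)]

lemma youngSub_self (n : ℕ) : youngSub n n = ⊤ :=
  eq_top_iff.2 fun _ _ j hj => absurd j.isLt (not_lt.2 hj)

lemma youngSub_mono {i j : ℕ} (h : i ≤ j) : youngSub n i ≤ youngSub n j :=
  fun _ hπ k hk => hπ k (h.trans hk)

end Young

section GelfandTsetlin

variable {n : ℕ}

lemma isInvariant_level (r : ℕ) (H : Subgroup (Equiv.Perm (Fin n))) :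
    IsInvariant (permRep n 1) H (level rk r) :=
  fun π _ _ hv => permRep_mem_level hv π

lemma cyclic_up_pow_vec_inf_weightSpace_le {t : ChainBottom n} (ht : t ∈ bottoms n) (j : ℕ) :
    cyclic (permRep n 1) ((up ^ j) t.vec) ⊓ weightSpace (permRep n 1) t.weight ≤
      Submodule.span ℂ {(up ^ j) t.vec} := by
  rintro y ⟨hy, hyt⟩
  have hyr := cyclic_le (isInvariant_level _ _) (t.up_pow_vec_mem_level j) hy
  obtain rfl | h0 := eq_or_ne y 0
  · exact Submodule.zero_mem _
  · obtain ⟨u, hu, hut, i, -, c, -, rfl⟩ := exists_eq_smul_up_pow_vec h0 hyr hyt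
    obtain rfl := eq_of_weight_eq hu ht hut
    have := level_unique h0 ((level rk _).smul_mem c (u.up_pow_vec_mem_level i)) hyr
    obtain rfl : i = j := by omega
    exact Submodule.smul_mem _ c (Submodule.mem_span_singleton_self _)

lemma isIrreducibleSub_cyclic_up_pow_vec {t : ChainBottom n} (ht : t ∈ bottoms n) {j : ℕ}
    (hj : 2 * t.rank + j ≤ n) :
    IsIrreducibleSub (permRep n 1) ⊤ (cyclic (permRep n 1) ((up ^ j) t.vec)) :=
  isIrreducibleSub_cyclic (t.up_pow_vec_ne_zero hj) (t.up_pow_vec_mem_weightSpace j)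
    (cyclic_up_pow_vec_inf_weightSpace_le ht j)

lemma isIrreducibleSub_cyclic_vec {t : ChainBottom n} (ht : t ∈ bottoms n) :
    IsIrreducibleSub (permRep n 1) ⊤ (cyclic (permRep n 1) t.vec) :=
  isIrreducibleSub_cyclic_up_pow_vec ht (j := 0) t.two_mul_rank_le

lemma exists_equivariant_vec_eq {t : ChainBottom (n + 1)} (ht : t ∈ bottoms (n + 1)) :
    ∃ u ∈ bottoms n, ∃ φ : (B n →₀ ℂ) →ₗ[ℂ] (B (n + 1) →₀ ℂ),
      (∀ τ v, φ (permRep n 1 τ v) = permRep (n + 1) 1 (permCast n τ) (φ v)) ∧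
        t.vec = φ u.vec := by
  obtain ⟨u, hu, rfl | ⟨h, rfl⟩⟩ := mem_bottoms_succ.1 ht
  · exact ⟨u, hu, snocMap 0, fun τ v => (permRep_permCast_snocMap τ 0 v).symm, rfl⟩
  · refine ⟨u, hu, ((n : ℂ) - 2 * u.rank) • snocMap 1 - snocMap 0 ∘ₗ up, fun τ v => ?_, rfl⟩
    simp only [LinearMap.sub_apply, LinearMap.smul_apply, LinearMap.comp_apply, map_sub, map_smul,
      permRep_permCast_snocMap, permRep_shift, up]

lemma isIrreducibleSub_orbitSpan_vec {t : ChainBottom n} (ht : t ∈ bottoms n) {i : ℕ}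
    (hi : i ≤ n) : IsIrreducibleSub (permRep n 1) (youngSub n i)
      (orbitSpan (permRep n 1) (youngSub n i) t.vec) := by
  induction n with
  | zero =>
    obtain rfl : i = 0 := by omega
    rw [youngSub_self, orbitSpan_top]
    exact isIrreducibleSub_cyclic_vec ht
  | succ n ih =>
    rcases hi.lt_or_eq with hi | rfl
    · obtain ⟨u, hu, φ, hφ, htu⟩ := exists_equivariant_vec_eq ht
      have h0 := t.vec_ne_zero
      rw [htu] at h0 ⊢
      rw [youngSub_succ_eq_map (Nat.le_of_lt_succ hi)]
      exact (ih hu (Nat.le_of_lt_succ hi)).map_orbitSpan_of_ne_zero hφ h0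
    · rw [youngSub_self, orbitSpan_top]
      exact isIrreducibleSub_cyclic_vec ht

lemma isGZVector_up_pow_vec {t : ChainBottom n} (ht : t ∈ bottoms n) {j : ℕ}
    (hj : 2 * t.rank + j ≤ n) :
    IsGZVector (permRep n 1) (level rk (t.rank + j)) ((up ^ j) t.vec) := by
  refine ⟨t.up_pow_vec_ne_zero hj,
    fun i => orbitSpan (permRep n 1) (youngSub n i) ((up ^ j) t.vec),
    fun i _ hi => ?_, fun i _ _ => orbitSpan_mono (youngSub_mono i.le_succ) _, ?_,
    mem_orbitSpan_self _⟩
  · have h := (isIrreducibleSub_orbitSpan_vec ht hi).map_orbitSpan_of_ne_zero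
      (f := MonoidHom.id _) (fun π v => up_pow_permRep π v j) (t.up_pow_vec_ne_zero hj)
    rwa [Subgroup.map_id] at h
  · beta_reduce
    rw [youngSub_self, orbitSpan_top]
    exact cyclic_le (isInvariant_level _ _) (t.up_pow_vec_mem_level j)

end GelfandTsetlin

section Jucys

variable {n : ℕ} {V : Type*} [AddCommGroup V] [Module ℂ V]
  {ρ : Representation ℂ (Equiv.Perm (Fin n)) V}

/-- The action of the sum of all `(a b)` over ordered pairs of letters `a, b < i`; it commutes with
`S_i` and consecutive sums differ by `2 X_i + 1`. -/
def swapSum (ρ : Representation ℂ (Equiv.Perm (Fin n)) V) (i : ℕ) : Module.End ℂ V :=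
  ∑ a ∈ {a : Fin n | (a : ℕ) < i}, ∑ b ∈ {b : Fin n | (b : ℕ) < i}, ρ (Equiv.swap a b)

lemma swapSum_apply (i : ℕ) (v : V) : swapSum ρ i v =
    ∑ a ∈ {a : Fin n | (a : ℕ) < i}, ∑ b ∈ {b : Fin n | (b : ℕ) < i}, ρ (Equiv.swap a b) v := by
  simp only [swapSum, LinearMap.sum_apply]

lemma swapSum_succ_apply (i : Fin n) (v : V) : swapSum ρ (i + 1) v =
    swapSum ρ i v + (2 : ℂ) • ρ.asAlgebraHom (yjm n i) v + v := by
  have hinsert : (Finset.univ.filter fun a : Fin n => (a : ℕ) < i + 1) =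
      insert i (Finset.univ.filter fun a : Fin n => (a : ℕ) < i) := by
    ext a
    simp only [Finset.mem_filter_univ, Finset.mem_insert, Fin.ext_iff]
    omega
  have hi : i ∉ Finset.univ.filter fun a : Fin n => (a : ℕ) < i := by simp
  simp only [swapSum_apply, yjm_apply, Fin.lt_def, hinsert, Finset.sum_insert hi,
    Finset.sum_add_distrib, two_smul, Equiv.swap_self, Equiv.swap_comm i, ← Equiv.Perm.one_def,
    map_one, Module.End.one_apply]
  abel

lemma apply_lt_iff_of_mem_youngSub {i : ℕ} {π : Equiv.Perm (Fin n)} (hπ : π ∈ youngSub n i)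
    (a : Fin n) : (π a : ℕ) < i ↔ (a : ℕ) < i := by
  rw [← not_iff_not, not_lt, not_lt]
  refine ⟨fun h => ?_, fun h => by rwa [hπ a h]⟩
  rwa [π.injective (hπ (π a) h)] at h

lemma swap_mem_youngSub {i : ℕ} {a b : Fin n} (ha : (a : ℕ) < i) (hb : (b : ℕ) < i) :
    Equiv.swap a b ∈ youngSub n i := fun _ hj =>
  Equiv.swap_apply_of_ne_of_ne (by rintro rfl; omega) (by rintro rfl; omega)

lemma swapSum_apply_comm {i : ℕ} {π : Equiv.Perm (Fin n)} (hπ : π ∈ youngSub n i) (v : V) :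
    swapSum ρ i (ρ π v) = ρ π (swapSum ρ i v) := by
  have hmem (a : Fin n) : (a ∈ Finset.univ.filter fun a : Fin n => (a : ℕ) < i) ↔
      π a ∈ Finset.univ.filter fun a : Fin n => (a : ℕ) < i := by
    simp only [Finset.mem_filter_univ, apply_lt_iff_of_mem_youngSub hπ]
  simp only [swapSum_apply, map_sum]
  refine (Finset.sum_equiv π hmem fun a _ => Finset.sum_equiv π hmem fun b _ => ?_).symm
  rw [← Module.End.mul_apply, ← map_mul, ← Module.End.mul_apply, ← map_mul,
    Equiv.swap_apply_apply, inv_mul_cancel_right]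

lemma IsIrreducibleSub.exists_swapSum_eq_smul [FiniteDimensional ℂ V] {i : ℕ} {L : Submodule ℂ V}
    (hL : IsIrreducibleSub ρ (youngSub n i) L) : ∃ c : ℂ, ∀ v ∈ L, swapSum ρ i v = c • v := by
  refine hL.exists_apply_eq_smul (fun v hv => ?_) fun π hπ v => swapSum_apply_comm hπ v
  rw [swapSum_apply]
  refine L.sum_mem fun a ha => L.sum_mem fun b hb => hL.invariant _ ?_ v hv
  exact swap_mem_youngSub (Finset.mem_filter_univ a |>.1 ha) (Finset.mem_filter_univ b |>.1 hb)

lemma mem_of_mem_one {L : ℕ → Submodule ℂ V} (hL : ∀ i, 1 ≤ i → i < n → L i ≤ L (i + 1)) {v : V}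
    (hv : v ∈ L 1) {i : ℕ} (hi : 1 ≤ i) (hin : i ≤ n) : v ∈ L i := by
  induction i, hi using Nat.le_induction with
  | base => exact hv
  | succ i hi ih => exact hL i hi hin (ih (Nat.le_of_lt hin))

namespace IsGZVector

variable {S : Submodule ℂ V} {v : V}

lemma mem (h : IsGZVector ρ S v) (hn : 1 ≤ n) : v ∈ S := by
  obtain ⟨-, L, -, hle, hS, hv⟩ := h
  exact hS (mem_of_mem_one hle hv hn le_rfl)

lemma exists_swapSum_eq_smul [FiniteDimensional ℂ V] (h : IsGZVector ρ S v) {i : ℕ} (hi : i ≤ n) :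
    ∃ c : ℂ, swapSum ρ i v = c • v := by
  obtain ⟨-, L, hirr, hle, -, hv⟩ := h
  rcases Nat.eq_zero_or_pos i with rfl | hpos
  · exact ⟨0, by simp [swapSum]⟩
  · obtain ⟨c, hc⟩ := (hirr i hpos hi).exists_swapSum_eq_smul
    exact ⟨c, hc v (mem_of_mem_one hle hv hpos hi)⟩

lemma isYJMEigenvector [FiniteDimensional ℂ V] (h : IsGZVector ρ S v) : IsYJMEigenvector ρ v := by
  refine ⟨h.1, fun i => ?_⟩
  obtain ⟨c, hc⟩ := h.exists_swapSum_eq_smul i.isLt.le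
  obtain ⟨d, hd⟩ := h.exists_swapSum_eq_smul i.isLt
  refine ⟨(d - c - 1) / 2, ?_⟩
  rw [Nat.succ_eq_add_one, swapSum_succ_apply, hc] at hd
  linear_combination (norm := module) (2⁻¹ : ℂ) • hd

end IsGZVector

end Jucys

section GZBasis

variable {n : ℕ}

lemma IsYJMEigenvector.exists_eq_smul_up_pow_vec {v : B n →₀ ℂ} {r : ℕ}
    (h : IsYJMEigenvector (permRep n 1) v) (hr : v ∈ level rk r) :
    ∃ t ∈ bottoms n, ∃ j, 2 * t.rank + j ≤ n ∧ ∃ c : ℂ, c ≠ 0 ∧ v = c • (up ^ j) t.vec := by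
  obtain ⟨h0, hα⟩ := h
  choose α hα using hα
  obtain ⟨t, ht, -, h⟩ := LinearBTK.exists_eq_smul_up_pow_vec h0 hr (mem_weightSpace_iff.2 hα)
  exact ⟨t, ht, h⟩

lemma isGZBasis_O (hn : 1 ≤ n) (r : ℕ) :
    IsGZBasis (permRep n 1) (level rk r) {v ∈ vectors (O n) | v ∈ level rk r} where
  linearIndependent := linearIndependent_of_orthogonal (fun v => ne_zero_of_mem_vectors_O v.2.1)
    fun v w h => vectors_O_pairwise n v.2.1 w.2.1 (Subtype.coe_ne_coe.2 h)
  span_eq := span_vectors_O_inter_level r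
  isGZVector := by
    rintro v ⟨hv, hr⟩
    obtain ⟨t, ht, j, hj, rfl⟩ := mem_vectors_O_iff.1 hv
    obtain rfl := level_unique (t.up_pow_vec_ne_zero hj) (t.up_pow_vec_mem_level j) hr
    exact isGZVector_up_pow_vec ht hj
  exists_smul v hv := by
    obtain ⟨t, ht, j, hj, c, hc, rfl⟩ :=
      hv.isYJMEigenvector.exists_eq_smul_up_pow_vec (hv.mem hn)
    refine ⟨_, ⟨mem_vectors_O_iff.2 ⟨t, ht, j, hj, rfl⟩, ?_⟩, c, rfl⟩
    exact ((level rk r).smul_mem_iff hc).1 (hv.mem hn)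

end GZBasis

section PermutationCharacter

variable {n : ℕ}

/-- The number of elements of `M(n,k)` fixed by `σ`, which is the value at `σ` of the character of
`V(M(n,k))`. -/
def fixedCount (k : ℕ) (σ : Equiv.Perm (Fin n)) : ℕ :=
  Fintype.card {a : Fin n → Fin (k + 1) // ∀ i, a (σ i) = a i}

lemma fixedCount_eq_sum (k : ℕ) (σ : Equiv.Perm (Fin n)) :
    fixedCount k σ = ∑ a : Fin n → Fin (k + 1), if ∀ i, a (σ i) = a i then 1 else 0 := by
  rw [fixedCount, Fintype.card_subtype, Finset.card_filter]

lemma fixedCount_succ_eq_sum (k : ℕ) (σ : Equiv.Perm (Fin (n + 1))) :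
    fixedCount k σ = ∑ b : Fin n → Fin (k + 1), ∑ s : Fin (k + 1),
      if ∀ i, Fin.snoc (α := fun _ => Fin (k + 1)) b s (σ i) =
        Fin.snoc (α := fun _ => Fin (k + 1)) b s i then 1 else 0 := by
  rw [fixedCount_eq_sum, ← (Fin.snocEquiv fun _ => Fin (k + 1)).sum_comp,
    Fintype.sum_prod_type_right]
  rfl

lemma fixedCount_permCast (k : ℕ) (τ : Equiv.Perm (Fin n)) :
    fixedCount k (permCast n τ) = (k + 1) * fixedCount k τ := by
  simp only [fixedCount_succ_eq_sum, fixedCount_eq_sum, Fin.forall_fin_succ', permCast_castSucc,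
    permCast_last, Fin.snoc_castSucc, and_true, Finset.sum_const, Finset.card_univ,
    Fintype.card_fin, smul_eq_mul, Finset.mul_sum]

lemma fixedCount_permCast_mul_swap (k : ℕ) (τ : Equiv.Perm (Fin n)) (j : Fin n) :
    fixedCount k (permCast n τ * Equiv.swap j.castSucc (Fin.last n)) = fixedCount k τ := by
  have hfixed (b : Fin n → Fin (k + 1)) (s : Fin (k + 1)) :
      (∀ i, Fin.snoc (α := fun _ => Fin (k + 1)) b s
        ((permCast n τ * Equiv.swap j.castSucc (Fin.last n)) i) =
          Fin.snoc (α := fun _ => Fin (k + 1)) b s i) ↔ s = b j ∧ ∀ i, b (τ i) = b i := by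
    rw [← (Equiv.swap j.castSucc (Fin.last n)).forall_congr_right]
    simp only [Equiv.Perm.mul_apply, Equiv.swap_apply_self, Fin.forall_fin_succ',
      permCast_castSucc, permCast_last, Fin.snoc_castSucc, Fin.snoc_last, Equiv.swap_apply_right]
    rw [and_comm, and_congr_right_iff]
    rintro rfl
    refine forall_congr' fun i => ?_
    obtain rfl | hij := eq_or_ne i j
    · rw [Equiv.swap_apply_left, Fin.snoc_last]
    · rw [Equiv.swap_apply_of_ne_of_ne (Fin.castSucc_injective n |>.ne hij)
        (Fin.castSucc_ne_last i), Fin.snoc_castSucc]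
  simp only [fixedCount_succ_eq_sum, fixedCount_eq_sum, hfixed, ite_and, Finset.sum_ite_eq',
    Finset.mem_univ, if_true]

/-- Indeed `∑ σ, fixedCount k σ • σ = ∏ i, (k + 1 + X_i)` in `ℂ[S_n]`. -/
lemma sum_fixedCount_smul {V : Type*} [AddCommGroup V] [Module ℂ V]
    (ρ : Representation ℂ (Equiv.Perm (Fin n)) V) (k : ℕ) {α : Fin n → ℂ} {w : V}
    (hw : w ∈ weightSpace ρ α) :
    ∑ σ, (fixedCount k σ : ℂ) • ρ σ w = (∏ i, (k + 1 + α i)) • w := by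
  induction n with
  | zero =>
    rw [Fintype.sum_unique, Fin.prod_univ_zero, Subsingleton.elim default 1, map_one]
    simp [fixedCount]
  | succ n ih =>
    rw [mem_weightSpace_iff] at hw
    have hres : w ∈ weightSpace (ρ.comp (permCast n)) fun i => α i.castSucc :=
      mem_weightSpace_iff.2 fun i => by rw [← yjm_castSucc_apply, hw]
    have hlast := hw (Fin.last n)
    rw [yjm_last_apply] at hlast
    rw [← (bijective_permCast_mul_swap n).sum_comp, Fintype.sum_prod_type, Fin.prod_univ_castSucc,
      mul_comm, ← smul_smul, ← ih _ hres, Finset.smul_sum]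
    refine Finset.sum_congr rfl fun τ _ => ?_
    rw [Fin.sum_univ_castSucc]
    simp only [fixedCount_permCast_mul_swap, Equiv.swap_self,
      ← Equiv.Perm.one_def, mul_one, fixedCount_permCast, ← Finset.smul_sum, map_mul,
      Module.End.mul_apply]
    rw [← map_sum, hlast, map_smul, MonoidHom.comp_apply]
    push_cast
    module

end PermutationCharacter

section OrbitHom

variable {n k : ℕ} {V : Type*} [AddCommGroup V] [Module ℂ V]
  {ρ : Representation ℂ (Equiv.Perm (Fin n)) V}

/-- The equivariant map from `V(M(n,k))` that sends `b` to the sum of all `σ w` with `σ a = b`. -/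
def orbitHom (ρ : Representation ℂ (Equiv.Perm (Fin n)) V) (a : MU n k) (w : V) :
    (MU n k →₀ ℂ) →ₗ[ℂ] V :=
  ∑ σ, (Finsupp.lapply fun i => a (σ⁻¹ i) : (MU n k →₀ ℂ) →ₗ[ℂ] ℂ).smulRight (ρ σ w)

lemma orbitHom_apply (a : MU n k) (w : V) (v : MU n k →₀ ℂ) :
    orbitHom ρ a w v = ∑ σ, v (fun i => a (σ⁻¹ i)) • ρ σ w := by
  simp only [orbitHom, LinearMap.sum_apply, LinearMap.smulRight_apply, Finsupp.lapply_apply]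

lemma orbitHom_permRep (a : MU n k) (w : V) (π : Equiv.Perm (Fin n)) (v : MU n k →₀ ℂ) :
    orbitHom ρ a w (permRep n k π v) = ρ π (orbitHom ρ a w v) := by
  simp only [orbitHom_apply, permRep_apply, map_sum, map_smul]
  refine Fintype.sum_equiv (Equiv.mulLeft π⁻¹) _ _ fun σ => ?_
  rw [Equiv.coe_mulLeft, ← Module.End.mul_apply, ← map_mul, mul_inv_cancel_left]
  rfl

lemma sum_orbitHom_single (w : V) : ∑ a : MU n k, orbitHom ρ a w (Finsupp.single a 1) =
    ∑ σ, (fixedCount k σ : ℂ) • ρ σ w := by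
  have hfixed (σ : Equiv.Perm (Fin n)) (a : Fin n → Fin (k + 1)) :
      (a = fun i => a (σ⁻¹ i)) ↔ ∀ i, a (σ i) = a i := by
    rw [funext_iff, ← σ.forall_congr_right]
    simp
  simp only [orbitHom_apply]
  rw [Finset.sum_comm]
  refine Finset.sum_congr rfl fun σ _ => ?_
  simp only [← Finset.sum_smul, fixedCount_eq_sum, Finsupp.single_apply, hfixed, Nat.cast_sum,
    Nat.cast_ite, Nat.cast_one, Nat.cast_zero]

lemma exists_equivariant_ne_zero {α : Fin n → ℂ} {w : V} (hw : w ∈ weightSpace ρ α) (h0 : w ≠ 0)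
    (hα : ∀ i, k + 1 + α i ≠ 0) : ∃ ψ : (MU n k →₀ ℂ) →ₗ[ℂ] V,
      (∀ π v, ψ (permRep n k π v) = ρ π (ψ v)) ∧ ψ ≠ 0 := by
  by_contra! h
  have hsum := sum_fixedCount_smul ρ k hw
  rw [← sum_orbitHom_single, Finset.sum_eq_zero fun a _ => by
    rw [h _ (orbitHom_permRep a w), LinearMap.zero_apply]] at hsum
  exact smul_ne_zero (Finset.prod_ne_zero_iff.2 fun i _ => hα i) h0 hsum.symm

end OrbitHom

section Transport

variable {n : ℕ} {V W : Type*} [AddCommGroup V] [Module ℂ V] [AddCommGroup W] [Module ℂ W]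
  {ρ : Representation ℂ (Equiv.Perm (Fin n)) V} {σ : Representation ℂ (Equiv.Perm (Fin n)) W}
  {φ : V →ₗ[ℂ] W}

lemma map_cyclic (hφ : ∀ π v, φ (ρ π v) = σ π (φ v)) (v : V) :
    (cyclic ρ v).map φ = cyclic σ (φ v) := by
  rw [← orbitSpan_top, map_orbitSpan (f := MonoidHom.id _) hφ, Subgroup.map_id, orbitSpan_top]

lemma isInvariant_ker (hφ : ∀ π v, φ (ρ π v) = σ π (φ v)) (H : Subgroup (Equiv.Perm (Fin n))) :
    IsInvariant ρ H (LinearMap.ker φ) := fun π _ v hv => by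
  rw [LinearMap.mem_ker] at hv ⊢
  rw [hφ, hv, map_zero]

lemma IsIrreducibleSub.mem_weightSpace_of_map (hφ : ∀ π v, φ (ρ π v) = σ π (φ v))
    {L : Submodule ℂ V} (hL : IsIrreducibleSub ρ ⊤ L) {z : V} (hz : z ∈ L) {γ : Fin n → ℂ}
    (hγ : φ z ∈ weightSpace σ γ) (h0 : φ z ≠ 0) : z ∈ weightSpace ρ γ := by
  have hdisj := (hL.le_or_disjoint (isInvariant_ker hφ ⊤)).resolve_left fun h => h0 (h hz)
  refine mem_weightSpace_iff.2 fun i => sub_eq_zero.1 (Submodule.disjoint_def.1 hdisj _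
    (L.sub_mem (hL.invariant.yjm_mem i hz) (L.smul_mem _ hz)) ?_)
  rw [LinearMap.mem_ker, map_sub, map_smul, map_yjm hφ, mem_weightSpace_iff.1 hγ, sub_self]

variable {t s u : ChainBottom n}

lemma up_pow_eq_zero_of_mem_cyclic {y : B n →₀ ℂ} (hy : y ∈ cyclic (permRep n 1) s.vec) {j : ℕ}
    (hj : n < 2 * s.rank + j) : (up ^ j) y = 0 :=
  cyclic_le (isInvariant_ker (fun π v => up_pow_permRep π v j) ⊤)
    ((s.up_pow_vec_eq_zero_iff j).2 hj) hy

lemma exists_vec_mem_cyclic {γ : Fin n → ℂ} {y : B n →₀ ℂ} (h0 : y ≠ 0)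
    (hy : y ∈ cyclic (permRep n 1) s.vec) (hγ : y ∈ weightSpace (permRep n 1) γ) :
    ∃ t ∈ bottoms n, t.weight = γ ∧ t.rank = s.rank ∧ t.vec ∈ cyclic (permRep n 1) s.vec := by
  have hyr := cyclic_le (isInvariant_level _ _) s.vec_mem_level hy
  obtain ⟨t, ht, htγ, j, hj, c, hc, rfl⟩ := exists_eq_smul_up_pow_vec h0 hyr hγ
  have hrank : t.rank + j = s.rank := level_unique h0
    ((level rk _).smul_mem c (t.up_pow_vec_mem_level j)) hyr
  have hzero := up_pow_eq_zero_of_mem_cyclic hy (j := n + 1 - 2 * s.rank) (by omega)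
  rw [map_smul, smul_eq_zero_iff_right hc, ← Module.End.mul_apply, ← pow_add,
    t.up_pow_vec_eq_zero_iff] at hzero
  have := s.two_mul_rank_le
  obtain rfl : j = 0 := by omega
  exact ⟨t, ht, htγ, hrank, (Submodule.smul_mem_iff _ hc).1 hy⟩

lemma exists_bottom_apply_ne_zero {ψ : (B n →₀ ℂ) →ₗ[ℂ] W}
    (hψ : ∀ π v, ψ (permRep n 1 π v) = σ π (ψ v)) (h0 : ψ ≠ 0) :
    ∃ s ∈ bottoms n, ∃ φ : (B n →₀ ℂ) →ₗ[ℂ] W,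
      (∀ π v, φ (permRep n 1 π v) = σ π (φ v)) ∧ φ s.vec ≠ 0 := by
  by_contra! h
  refine h0 (LinearMap.ext_on (span_vectors_O n) fun v hv => ?_)
  obtain ⟨s, hs, j, -, rfl⟩ := mem_vectors_O_iff.1 hv
  exact h s hs (ψ ∘ₗ up ^ j) fun π v => by simp only [LinearMap.comp_apply, up_pow_permRep, hψ]

lemma IsIrreducibleSub.exists_bottom_of_equivariant (hσ : IsIrreducibleSub σ ⊤ ⊤)
    {ψ : (B n →₀ ℂ) →ₗ[ℂ] W} (hψ : ∀ π v, ψ (permRep n 1 π v) = σ π (ψ v)) (h0 : ψ ≠ 0) :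
    ∃ s ∈ bottoms n, ∀ γ, weightSpace σ γ ≠ ⊥ →
      ∃ t ∈ bottoms n, t.weight = γ ∧ t.rank = s.rank ∧ t.vec ∈ cyclic (permRep n 1) s.vec := by
  obtain ⟨s, hs, φ, hφ, hφ0⟩ := exists_bottom_apply_ne_zero hψ h0
  have htop : (cyclic (permRep n 1) s.vec).map φ = ⊤ := by
    rw [map_cyclic hφ, hσ.cyclic_eq trivial hφ0]
  have hirr := isIrreducibleSub_cyclic_vec hs
  refine ⟨s, hs, fun γ hγ => ?_⟩
  obtain ⟨x, hx, hx0⟩ := Submodule.ne_bot_iff _ |>.1 hγ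
  obtain ⟨y, hy, rfl⟩ : x ∈ (cyclic (permRep n 1) s.vec).map φ := htop ▸ trivial
  exact exists_vec_mem_cyclic (fun h => hx0 (by rw [h, map_zero])) hy
    (hirr.mem_weightSpace_of_map hφ hy hx hx0)

namespace WeightEquiv

variable {α β : Fin n → ℂ}

lemma symm (h : WeightEquiv n α β) : WeightEquiv n β α := by
  obtain ⟨L, i₁, i₂, i₃, σ, hσ, hα, hβ⟩ := h
  exact ⟨L, i₁, i₂, i₃, σ, hσ, hβ, hα⟩

lemma exists_bottoms (h : WeightEquiv n α β) (hα : weightSpace (permRep n 1) α ≠ ⊥) :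
    ∃ t ∈ bottoms n, ∃ u ∈ bottoms n, t.weight = α ∧ u.weight = β ∧ t.rank = u.rank ∧
      u.vec ∈ cyclic (permRep n 1) t.vec := by
  obtain ⟨L, _, _, _, σ, hσ, ⟨v, hv, hv0, -⟩, ⟨w, hw, hw0, -⟩⟩ := h
  obtain ⟨p, hp, rfl⟩ := exists_weight_eq_of_weightSpace_ne_bot hα
  obtain ⟨ψ, hψ, hψ0⟩ := exists_equivariant_ne_zero (k := 1) hv hv0 fun i => by
    have := two_add_weight_ne_zero hp i
    norm_num [this]
  obtain ⟨s, hs, hbottom⟩ := hσ.exists_bottom_of_equivariant hψ hψ0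
  obtain ⟨t, ht, htα, hts, htmem⟩ := hbottom _ (Submodule.ne_bot_iff _ |>.2 ⟨v, hv, hv0⟩)
  obtain ⟨u, hu, huβ, hus, humem⟩ := hbottom _ (Submodule.ne_bot_iff _ |>.2 ⟨w, hw, hw0⟩)
  have hirr := isIrreducibleSub_cyclic_vec hs
  refine ⟨t, ht, u, hu, htα, huβ, hts.trans hus.symm, ?_⟩
  exact (hirr.cyclic_eq htmem t.vec_ne_zero).symm ▸ humem

lemma weightSpace_eq_bot (h : WeightEquiv n α β) (hα : weightSpace (permRep n 1) α = ⊥) :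
    weightSpace (permRep n 1) β = ⊥ := by
  by_contra hβ
  obtain ⟨_, -, u, -, -, rfl, -⟩ := h.symm.exists_bottoms hβ
  have hu := u.vec_mem_weightSpace
  rw [hα, Submodule.mem_bot] at hu
  exact u.vec_ne_zero hu

end WeightEquiv

namespace ChainBottom

lemma linearIndependent_up_pow_vec (t : ChainBottom n) :
    LinearIndependent ℂ fun j : Fin (n - 2 * t.rank + 1) => (up ^ (j : ℕ)) t.vec := by
  have := t.two_mul_rank_le
  refine linearIndependent_of_orthogonal (fun j => t.up_pow_vec_ne_zero (by omega))
    fun i j hij => ?_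
  exact stdInner_eq_zero_of_level_ne (t.up_pow_vec_mem_level i) (t.up_pow_vec_mem_level j)
    fun h => hij (Fin.ext (by omega))

/-- The chain of `t` as a basis of the weight space of `t`. -/
def weightBasis (ht : t ∈ bottoms n) : Module.Basis (Fin (n - 2 * t.rank + 1)) ℂ
    (weightSpace (permRep n 1) t.weight) :=
  (Module.Basis.span t.linearIndependent_up_pow_vec).map
    (LinearEquiv.ofEq _ _ (weightSpace_eq_span_range ht).symm)

lemma coe_weightBasis (ht : t ∈ bottoms n) (j : Fin (n - 2 * t.rank + 1)) :
    (weightBasis ht j : B n →₀ ℂ) = (up ^ (j : ℕ)) t.vec := by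
  rw [weightBasis, Module.Basis.map_apply, LinearEquiv.coe_ofEq_apply, Module.Basis.span_apply]

/-- The isomorphism of weight spaces matching the chains of two bottoms of equal rank; it is the
canonical isomorphism `f_{α,β}` when the bottoms generate the same `S_n`-submodule. -/
def weightEquiv (ht : t ∈ bottoms n) (hu : u ∈ bottoms n) (h : t.rank = u.rank) :
    weightSpace (permRep n 1) t.weight ≃ₗ[ℂ] weightSpace (permRep n 1) u.weight :=
  (weightBasis ht).equiv (weightBasis hu) (finCongr (by rw [h]))

lemma coe_weightEquiv_weightBasis (ht : t ∈ bottoms n) (hu : u ∈ bottoms n) (h : t.rank = u.rank)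
    (j : Fin (n - 2 * t.rank + 1)) :
    (weightEquiv ht hu h (weightBasis ht j) : B n →₀ ℂ) = (up ^ (j : ℕ)) u.vec := by
  rw [weightEquiv, Module.Basis.equiv_apply, coe_weightBasis]
  rfl

lemma exists_equivariant_apply_vec_eq (ht : t ∈ bottoms n) (hu : u ∈ bottoms n)
    (h : t.rank = u.rank) (v : weightSpace (permRep n 1) t.weight) :
    ∃ φ : Module.End ℂ (B n →₀ ℂ), (∀ π x, φ (permRep n 1 π x) = permRep n 1 π (φ x)) ∧
      φ t.vec = v ∧ φ u.vec = weightEquiv ht hu h v := by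
  refine ⟨∑ j, (weightBasis ht).repr v j • up ^ (j : ℕ), fun π x => ?_, ?_, ?_⟩
  · simp only [LinearMap.sum_apply, LinearMap.smul_apply, up_pow_permRep, map_sum, map_smul]
  · conv_rhs => rw [← (weightBasis ht).sum_repr v]
    simp only [LinearMap.sum_apply, LinearMap.smul_apply, Submodule.coe_sum, Submodule.coe_smul,
      coe_weightBasis]
  · conv_rhs => rw [← (weightBasis ht).sum_repr v]
    simp only [LinearMap.sum_apply, LinearMap.smul_apply, Submodule.coe_sum, Submodule.coe_smul,
      map_sum, map_smul, coe_weightEquiv_weightBasis]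

lemma isCanonicalIso_weightEquiv (ht : t ∈ bottoms n) (hu : u ∈ bottoms n) (h : t.rank = u.rank)
    (htu : u.vec ∈ cyclic (permRep n 1) t.vec) :
    IsCanonicalIso (permRep n 1) t.weight u.weight (weightEquiv ht hu h) := by
  intro v
  obtain ⟨φ, hφ, hφt, hφu⟩ := exists_equivariant_apply_vec_eq ht hu h v
  have hirr := isIrreducibleSub_cyclic_vec ht
  rw [← hφt, ← map_cyclic hφ, ← hφu]
  refine le_antisymm ?_ (Submodule.span_singleton_le_iff_mem .. |>.2 ⟨⟨_, htu, rfl⟩, ?_⟩)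
  · rintro _ ⟨⟨z, hz, rfl⟩, hzu⟩
    obtain h0 | h0 := eq_or_ne (φ z) 0
    · exact h0 ▸ Submodule.zero_mem _
    · have hzw := hirr.mem_weightSpace_of_map hφ hz hzu h0
      rw [SetLike.mem_coe, ← hirr.cyclic_eq htu u.vec_ne_zero] at hz
      obtain ⟨c, rfl⟩ := Submodule.mem_span_singleton.1
        (cyclic_up_pow_vec_inf_weightSpace_le hu 0 ⟨hz, hzw⟩)
      exact Submodule.mem_span_singleton.2 ⟨c, (map_smul φ c _).symm⟩
  · exact hφu ▸ (weightEquiv ht hu h v).2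

lemma weightEquiv_mem_vectors_O (ht : t ∈ bottoms n) (hu : u ∈ bottoms n) (h : t.rank = u.rank)
    {v : weightSpace (permRep n 1) t.weight} (hv : (v : B n →₀ ℂ) ∈ vectors (O n)) :
    (weightEquiv ht hu h v : B n →₀ ℂ) ∈ vectors (O n) := by
  obtain ⟨s, hs, j, hj, hvj⟩ := mem_vectors_O_iff.1 hv
  obtain rfl := eq_of_weight_eq hs ht (s.weight_eq_of_mem hj (hvj ▸ v.2))
  obtain rfl : v = weightBasis hs ⟨j, by omega⟩ := Subtype.ext (by rw [← hvj, coe_weightBasis])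
  rw [coe_weightEquiv_weightBasis]
  exact mem_vectors_O_iff.2 ⟨u, hu, j, h ▸ hj, rfl⟩

end ChainBottom

lemma isYJMEigenvector_of_mem_vectors_O {v : B n →₀ ℂ} (hv : v ∈ vectors (O n)) :
    IsYJMEigenvector (permRep n 1) v := by
  obtain ⟨t, -, j, -, rfl⟩ := mem_vectors_O_iff.1 hv
  exact ⟨ne_zero_of_mem_vectors_O hv, fun i =>
    ⟨t.weight i, mem_weightSpace_iff.1 (t.up_pow_vec_mem_weightSpace j) i⟩⟩

lemma isSGZB_O (n : ℕ) : IsSGZB n 1 (O n) where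
  isSJB := isSJB_O n
  eigenvector _ := isYJMEigenvector_of_mem_vectors_O
  transport α β h := by
    by_cases hα : weightSpace (permRep n 1) α = ⊥
    · have hβ := h.weightSpace_eq_bot hα
      have hz (v : weightSpace (permRep n 1) α) : (v : B n →₀ ℂ) = 0 := by simpa [hα] using v.2
      refine ⟨LinearEquiv.ofEq _ _ (hα.trans hβ.symm), fun v => ?_, fun v hv => ?_⟩
      · rw [LinearEquiv.coe_ofEq_apply, hβ, inf_bot_eq, hz, Submodule.span_zero_singleton]
      · exact absurd (hz v) (ne_zero_of_mem_vectors_O hv)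
    · obtain ⟨t, ht, u, hu, rfl, rfl, hrank, htu⟩ := h.exists_bottoms hα
      refine ⟨ChainBottom.weightEquiv ht hu hrank,
        ChainBottom.isCanonicalIso_weightEquiv ht hu hrank htu, fun v hv => ⟨1, ?_⟩⟩
      rw [one_smul]
      exact ChainBottom.weightEquiv_mem_vectors_O ht hu hrank hv

end Transport

section Uniqueness

namespace IsSymmetricJordanChain

lemma getElem_eq_pow_apply_head {P : Type*} [Fintype P] [PartialOrder P] {r : P → ℕ}
    {l : List (P →₀ ℂ)} (hc : IsSymmetricJordanChain r l) (i : ℕ) (hi : i < l.length) :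
    l[i] = (upOp P ^ i) (l.head hc.ne_nil) := by
  induction i with
  | zero => exact (List.head_eq_getElem hc.ne_nil).symm
  | succ i ih =>
    rw [← List.isChain_iff_getElem.1 hc.up_eq i hi, ih (by omega), pow_succ', Module.End.mul_apply]

variable {n : ℕ} {l : List (B n →₀ ℂ)}

lemma eq_map_chain (hc : IsSymmetricJordanChain rk l) {t : ChainBottom n} {j : ℕ} {a : ℂ}
    (hhead : l.head hc.ne_nil = a • (up ^ j) t.vec) : l = t.chain.map (a • ·) := by
  have hpos : 0 < l.length := List.length_pos_of_ne_nil hc.ne_nil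
  have hget (i : ℕ) (hi : i < l.length) : l[i] = a • (up ^ (j + i)) t.vec := by
    rw [hc.getElem_eq_pow_apply_head i hi, hhead, upOp_eq_up, map_smul, add_comm, pow_add,
      Module.End.mul_apply]
  have hlast : l.getLast hc.ne_nil = a • (up ^ (j + (l.length - 1))) t.vec := by
    rw [List.getLast_eq_getElem, hget]
  have hhead0 := hc.ne_zero _ (List.head_mem hc.ne_nil)
  have hlast0 := hc.ne_zero _ (List.getLast_mem hc.ne_nil)
  have ha : a ≠ 0 := (smul_ne_zero_iff.1 (hhead ▸ hhead0)).1
  have hle : ¬ n < 2 * t.rank + (j + (l.length - 1)) := fun h =>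
    hlast0 (by rw [hlast, (t.up_pow_vec_eq_zero_iff _).2 h, smul_zero])
  have hlt : n < 2 * t.rank + (j + (l.length - 1) + 1) := by
    have hup := hc.up_last
    rwa [hlast, map_smul, smul_eq_zero_iff_right ha, upOp_eq_up, ← Module.End.mul_apply,
      ← pow_succ', t.up_pow_vec_eq_zero_iff] at hup
  obtain ⟨r, s, hr, hs, hrs⟩ := hc.symmetric
  have hr' : r = t.rank + j := level_unique hhead0 hr
    (hhead ▸ Submodule.smul_mem _ _ (t.up_pow_vec_mem_level _))
  have hs' : s = t.rank + (j + (l.length - 1)) := level_unique hlast0 hs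
    (hlast ▸ Submodule.smul_mem _ _ (t.up_pow_vec_mem_level _))
  rw [sup_rk] at hrs
  obtain rfl : j = 0 := by omega
  refine List.ext_getElem ?_ fun i hi _ => ?_
  · simp only [ChainBottom.chain, List.length_map, List.length_range]
    omega
  · simp only [hget i hi, ChainBottom.chain, List.getElem_map, List.getElem_range, zero_add]

end IsSymmetricJordanChain

namespace IsSJB

variable {n : ℕ} {L : List (List (B n →₀ ℂ))}

lemma exists_eq_map_chain (hL : IsSJB rk L)
    (h : ∀ v ∈ vectors L, IsYJMEigenvector (permRep n 1) v) {c : List (B n →₀ ℂ)} (hc : c ∈ L) :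
    ∃ t ∈ bottoms n, ∃ a : ℂ, a ≠ 0 ∧ c = t.chain.map (a • ·) := by
  have hJ := hL.chains c hc
  have hhead := List.head_mem hJ.ne_nil
  obtain ⟨r, hr⟩ := hJ.homogeneous _ hhead
  obtain ⟨t, ht, j, -, a, ha, hv⟩ := (h _ ⟨c, hc, hhead⟩).exists_eq_smul_up_pow_vec hr
  exact ⟨t, ht, a, ha, hJ.eq_map_chain hv⟩

lemma sameUpToScalars_O (hL : IsSJB rk L)
    (h : ∀ v ∈ vectors L, IsYJMEigenvector (permRep n 1) v) : SameUpToScalars (O n) L := by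
  rw [O_eq_map_chain]
  refine ⟨List.forall_mem_map.2 fun t ht => ?_, fun c hc => ?_⟩
  · by_contra! hne
    have horth (x) (hx : x ∈ vectors L) : stdInner x t.vec = 0 := by
      obtain ⟨c, hc, hxc⟩ := hx
      obtain ⟨u, hu, a, ha, rfl⟩ := hL.exists_eq_map_chain h hc
      obtain ⟨y, hy, rfl⟩ := List.mem_map.1 hxc
      obtain ⟨j, -, rfl⟩ := u.mem_chain_iff.1 hy
      refine stdInner_eq_zero_of_weight_ne
        (Submodule.smul_mem _ a (u.up_pow_vec_mem_weightSpace j)) t.vec_mem_weightSpace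
        fun hut => ?_
      obtain rfl := eq_of_weight_eq hu ht hut
      exact hne _ hc a ha rfl
    have hspan : vectors L ⊆ LinearMap.ker (stdForm (B n) t.vec) := fun x hx => by
      rw [SetLike.mem_coe, LinearMap.mem_ker, stdForm_apply, stdInner_eq_zero_comm, horth x hx]
    have htop := Submodule.span_le.2 hspan
    rw [hL.span_eq_top] at htop
    exact t.vec_ne_zero (stdInner_self_eq_zero.1 (htop trivial))
  · obtain ⟨t, ht, a, ha, rfl⟩ := hL.exists_eq_map_chain h hc
    exact ⟨t.chain, List.mem_map_of_mem ht, a, ha, rfl⟩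

end IsSJB

lemma IsGZUnion.isYJMEigenvector {n : ℕ} {L : List (List (B n →₀ ℂ))} (hL : IsGZUnion n L)
    {v : B n →₀ ℂ} (hv : v ∈ vectors L) : IsYJMEigenvector (permRep n 1) v := by
  have hvL := hv
  obtain ⟨c, hc, hvc⟩ := hvL
  obtain ⟨r, hr⟩ := (hL.isSJB.chains c hc).homogeneous v hvc
  have hrn := le_of_mem_level ((hL.isSJB.chains c hc).ne_zero v hvc) hr
  exact ((hL.gzBasis r hrn).isGZVector v ⟨hv, hr⟩).isYJMEigenvector

lemma isGZUnion_O {n : ℕ} (hn : 1 ≤ n) : IsGZUnion n (O n) where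
  isSJB := isSJB_O n
  orthogonal _ hv _ hw := vectors_O_pairwise n hv hw
  gzBasis r _ := isGZBasis_O hn r

end Uniqueness

end LinearBTK

end

theorem theorem3 (n : ℕ) (hn : 1 ≤ n) :
    LinearBTK.IsGZUnion n (LinearBTK.O n) ∧
    LinearBTK.IsSGZB n 1 (LinearBTK.O n) ∧
    ∀ L : List (List (LinearBTK.B n →₀ ℂ)),
      LinearBTK.IsGZUnion n L ∨ LinearBTK.IsSGZB n 1 L →
        LinearBTK.SameUpToScalars (LinearBTK.O n) L := by
  refine ⟨LinearBTK.isGZUnion_O hn, LinearBTK.isSGZB_O n, ?_⟩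
  rintro L (hL | hL)
  · exact hL.isSJB.sameUpToScalars_O fun _ hv => hL.isYJMEigenvector hv
  · exact hL.isSJB.sameUpToScalars_O hL.eigenvector
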